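/- **Theorem.** There are absolute constants $c, C>0$ with the following property. Let $n\ge 0$, $m\ge 2$, $\alpha>0$, $\varepsilon>0$, $\delta\in(0,1)$, and let $A_1,\dots,A_m$ be real $n\times n$ matrices, accessible only through matrix-vector products $x\mapsto A_i x$ (each product is one query). Consider the following randomized algorithm, with $L=\lceil\log_2 m\rceil$. * For a square matrix $M$ and $\varepsilon',\delta'>0$, $\mathrm{Hutch}^{++}(M,\varepsilon',\delta')$ draws two independent $n\times q$ matrices $S,G$ with i.i.d. uniform $\pm1$ entries, where $q=\lceil c(\sqrt{\log(1/\delta')}/\varepsilon'+\log(1/\delta'))\rceil$, computes an orthonormal basis $Q$ of the column space of $MS$, and returns $\mathrm{tr}(Q^TMQ)+\frac1q\,\mathrm{tr}\big(G^T(I-QQ^T)M(I-QQ^T)G\big)$. * Compute $t_0=\mathrm{Hutch}^{++}(A_1,\varepsilon/2,\delta/2)$ and, for every level $\ell=0,\dots,L-1$ and every $k=1,\dots,\lfloor (m-1)/2^\ell\rfloor$, with fresh randomness, $$t_{k,\ell}=\mathrm{Hutch}^{++}\big(A_{1+k2^\ell}-A_{1+(k-1)2^\ell},\ \varepsilon'(\ell),\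 \delta/m\big),\qquad \varepsilon'(\ell)=\frac{\varepsilon}{2^{\ell+1}\alpha L}.$$ * For $i=1,\dots,m$ output $t_i=t_0+\sum t_{k,\ell}$, where the sum is over the decomposition of the interval from $0$ to $i-1$ into dyadic intervals $[(k-1)2^\ell,k2^\ell]$ of different lengths, longest first (the binary expansion of $i-1$). Then: 1. the algorithm always makes at most $$C\left(\big(m\alpha\log^2 m+1\big)\frac{\sqrt{\log(m/\delta)}}{\varepsilon}+m\log(m/\delta)\right)$$ matrix-vector queries to $A_1,\dots,A_m$; 2. $t_i$ depends only on $A_1,\dots,A_i$ and the randomness; 3. if $\|A_1\|_*\le 1$ and $\|A_{i+1}-A_i\|_*\le\alpha$ for all $1\le i\le m-1$ (with no bound on the norms of $A_2,\dots,A_m$), where $\|\cdot\|_*$ is the nuclear norm, then with probability at least $1-\delta$ we have $|t_i-\mathrm{tr}\,A_i|\le\varepsilon$ for all $i=1,\dots,m$. -/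

import Mathlib

noncomputable section

/-- Real column vectors of length `n`, with the Euclidean inner product. -/
abbrev Vec (n : ℕ) : Type := EuclideanSpace ℝ (Fin n)

/-- The nuclear norm (Schatten 1-norm) of a square real matrix: the sum of its singular values. -/
def nuclearNorm {n : ℕ} (A : Matrix (Fin n) (Fin n) ℝ) : ℝ :=
  ∑ i : Fin n, (Matrix.toEuclideanLin A).singularValues i

/-- The matrix-vector query model: (deterministic, adaptive) algorithms that interact with a
family of `n × n` matrices indexed by `ι`. An algorithm either stops with an output, or
asks for the product of the `i`-th matrix with a vector `x` and continues depending on the answer.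
A randomized algorithm is such an algorithm depending on a random seed. -/
inductive MatVecAlg (n : ℕ) (ι : Type) (β : Type) : Type
  | done (b : β) : MatVecAlg n ι β
  | query (i : ι) (x : Vec n) (next : Vec n → MatVecAlg n ι β) : MatVecAlg n ι β

namespace MatVecAlg

variable {n : ℕ} {ι β γ : Type}

/-- The output of the algorithm on the matrices `A`. -/
def output (A : ι → Matrix (Fin n) (Fin n) ℝ) : MatVecAlg n ι β → β
  | done b => b
  | query i x next => (next (Matrix.toEuclideanLin (A i) x)).output A

/-- The number of matrix-vector products that the algorithm asks for on the matrices `A`. -/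
def queryCount (A : ι → Matrix (Fin n) (Fin n) ℝ) : MatVecAlg n ι β → ℕ
  | done _ => 0
  | query i x next => (next (Matrix.toEuclideanLin (A i) x)).queryCount A + 1

/-- Sequential composition. -/
def bind : MatVecAlg n ι β → (β → MatVecAlg n ι γ) → MatVecAlg n ι γ
  | done b, f => f b
  | query i x next, f => query i x fun y => (next y).bind f

/-- A for-loop: run `f 0`, …, `f (q - 1)` one after the other and collect the results. -/
def forEach : {q : ℕ} → {β : Fin q → Type} → (∀ j, MatVecAlg n ι (β j)) →
    MatVecAlg n ι (∀ j, β j)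
  | 0, _, _ => done fun j => j.elim0
  | _ + 1, β, f =>
    (f 0).bind fun b => (forEach fun j => f j.succ).bind fun bs => done (Fin.cons (α := β) b bs)

/-- The product `A i * x`, at the cost of one query. -/
def mulVec (i : ι) (x : Vec n) : MatVecAlg n ι (Vec n) :=
  query i x done

/-- The product `(A i - A j) * x`, at the cost of two queries. -/
def subMulVec (i j : ι) (x : Vec n) : MatVecAlg n ι (Vec n) :=
  query i x fun y => query j x fun z => done (y - z)

end MatVecAlg

/-- `q` sign vectors of length `n` (`true` stands for `1` and `false` for `-1`). -/
abbrev SignSeed (n q : ℕ) : Type := Fin q → Fin n → Bool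

/-- The `j`-th of the sign vectors given by a seed. -/
def SignSeed.vec {n q : ℕ} (S : SignSeed n q) (j : Fin q) : Vec n :=
  WithLp.toLp 2 fun a => if S j a then 1 else -1

/-- The randomness of one run of Hutch++: two independent `n × q` random sign matrices. -/
abbrev HutchSeed (n q : ℕ) : Type := SignSeed n q × SignSeed n q

open MatVecAlg in
/-- The Hutch++ trace estimator for a matrix `M` accessed through `mv x = M * x`. With sign
matrices `S`, `G` with `q` columns, and `Q` a matrix whose columns are an orthonormal basis of
the column space of `M * S` (Gram-Schmidt, possibly with additional zero columns), it returns
`tr (Qᵀ M Q) + (1 / q) tr (Gᵀ (1 - Q Qᵀ) M (1 - Q Qᵀ) G)`. -/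
def hutchPP {n : ℕ} {ι : Type} (mv : Vec n → MatVecAlg n ι (Vec n)) {q : ℕ}
    (seed : HutchSeed n q) : MatVecAlg n ι ℝ :=
  (forEach fun j : Fin q => mv (seed.1.vec j)).bind fun MS =>
  let Q : Fin q → Vec n := InnerProductSpace.gramSchmidtNormed ℝ MS
  (forEach fun j : Fin q => mv (Q j)).bind fun MQ =>
  let W : Fin q → Vec n := fun j => seed.2.vec j - ∑ a, inner ℝ (Q a) (seed.2.vec j) • Q a
  (forEach fun j : Fin q => mv (W j)).bind fun MW =>
  done (∑ j, inner ℝ (Q j) (MQ j) + (1 / (q : ℝ)) * ∑ j, inner ℝ (W j) (MW j))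

/-- The number of columns of the sign matrices in `Hutch++(·, ε, δ)`, with the constant `c`. -/
def hutchSize (c ε δ : ℝ) : ℕ :=
  ⌈c * (√(Real.log (1 / δ)) / ε + Real.log (1 / δ))⌉₊

/-- The number of levels of the binary tree over `m` matrices: `log₂ m`, rounded up. -/
def numLevels (m : ℕ) : ℕ := Nat.clog 2 m

/-- The accuracy parameter of Hutch++ at level `l` of the tree. -/
def levelEps (m : ℕ) (α ε : ℝ) (l : ℕ) : ℝ :=
  ε / (2 ^ (l + 1) * α * numLevels m)

/-- The size parameter of the calls of Hutch++ at level `l` of the tree. -/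
def levelSize (c : ℝ) (m : ℕ) (α ε δ : ℝ) (l : ℕ) : ℕ :=
  hutchSize c (levelEps m α ε l) (δ / m)

/-- The randomness of the tree algorithm: a separate seed of Hutch++ for the first matrix and
for every node of the tree. The nodes at level `l` are numbered `k = 1, …, ⌊(m - 1) / 2 ^ l⌋`;
here node `k` has index `k - 1`. -/
abbrev TreeSeed (c : ℝ) (n m : ℕ) (α ε δ : ℝ) : Type :=
  HutchSeed n (hutchSize c (ε / 2) (δ / 2)) ×
    (∀ l : Fin (numLevels m), Fin ((m - 1) / 2 ^ (l : ℕ)) →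
      HutchSeed n (levelSize c m α ε δ l))

/-- `sumTree t l p j`, for `p ≤ j < p + 2 ^ l` with `p` a multiple of `2 ^ l`, decomposes the
interval from `p` to `j` into at most one dyadic interval of each length `2 ^ (l - 1), …, 2, 1`,
longest first, and adds up their values, where `t k l'` is the value of the interval from
`(k - 1) * 2 ^ l'` to `k * 2 ^ l'`. -/
def sumTree (t : ℕ → ℕ → ℝ) : ℕ → ℕ → ℕ → ℝ
  | 0, _, _ => 0
  | l + 1, p, j =>
    if p + 2 ^ l ≤ j then t (p / 2 ^ l + 1) l + sumTree t l (p + 2 ^ l) j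
    else sumTree t l p j

theorem treeNode_lt {m : ℕ} (hm : 0 < m) (l : ℕ) (k : Fin ((m - 1) / 2 ^ l)) :
    (k + 1) * 2 ^ l < m := by
  have h : ((k : ℕ) + 1) * 2 ^ l ≤ m - 1 :=
    (Nat.mul_le_mul_right _ k.isLt).trans (Nat.div_mul_le_self _ _)
  omega

theorem treeNode_pred_lt {m : ℕ} (hm : 0 < m) (l : ℕ) (k : Fin ((m - 1) / 2 ^ l)) :
    k * 2 ^ l < m :=
  (Nat.mul_le_mul_right _ (Nat.le_succ _)).trans_lt (treeNode_lt hm l k)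

open MatVecAlg in
/-- The binary tree algorithm with all `m` matrices in one group, on the matrices
`A 0, …, A (m - 1)`. It computes `t₀ = Hutch++(A 0, ε / 2, δ / 2)` and, for every level `l` and
every `k = 1, …, ⌊(m - 1) / 2 ^ l⌋`,
`t k l = Hutch++(A (k * 2 ^ l) - A ((k - 1) * 2 ^ l), levelEps m α ε l, δ / m)`,
and outputs for every `i` the estimate `t₀ + sumTree t (numLevels m) 0 i` of the trace of `A i`.
The number of columns used in Hutch++ involves the constant `c`. -/
def treeAlgorithm (c : ℝ) (n m : ℕ) (hm : 0 < m) (α ε δ : ℝ) (seed : TreeSeed c n m α ε δ) :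
    MatVecAlg n (Fin m) (Fin m → ℝ) :=
  (hutchPP (mulVec ⟨0, hm⟩) seed.1).bind fun t₀ =>
  (forEach fun l : Fin (numLevels m) => forEach fun k : Fin ((m - 1) / 2 ^ (l : ℕ)) =>
    hutchPP (subMulVec ⟨(k + 1) * 2 ^ (l : ℕ), treeNode_lt hm l k⟩
      ⟨k * 2 ^ (l : ℕ), treeNode_pred_lt hm l k⟩) (seed.2 l k)).bind fun T =>
  let t : ℕ → ℕ → ℝ := fun k l =>
    if hl : l < numLevels m then
      if hk : k - 1 < (m - 1) / 2 ^ l then T ⟨l, hl⟩ ⟨k - 1, hk⟩ else 0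
    else 0
  done fun i => t₀ + sumTree t (numLevels m) 0 i

end

open scoped BigOperators
open InnerProductSpace

/-! Splitting `Q Qᵀ` off the trace shows that the error of Hutch++ on `T` is exactly Hutchinson's
error on the residual `(1 - Q Qᵀ) T (1 - Q Qᵀ)` (`hutchValue_sub_trace`). A Chernoff bound for
quadratic forms in random signs (`expect_exp_quadForm_le`, `unifProb_hutchinson_le`) controls it by
the Hilbert-Schmidt norm of the residual.

That norm is small because sketching amounts to removing the directions `T s` one at a time. If `φ`
is the squared Hilbert-Schmidt norm and `N` bounds the nuclear norm, one removal typically lowers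
`φ` by about `‖TᵀT‖² / φ`, which is at least `φ² / N²` by Hölder (`NuclearBound.hsSq_cube_le`). Thus
`1 / φ` grows by about `1 / N²` per step, and `φ` is of order `N² / q` after `q` steps. For high
probability, the potential `exp (-8 N² / φ)` is shown to shrink in expectation by a constant factor
per step (`expect_residualPotential_deflate_le`). Markov's inequality and the Chernoff bound combine
in `unifProb_hutchValue_le`.

In the tree, a node at level `l` has nuclear norm at most `2 ^ l * α`, so its allowed error is `ε /
(2 L)`. An estimate uses at most one node per level, hence a total error of `ε / 2` beyond that of
`t₀`. There are at most `2 m` nodes for the union bound, and the factor `2 ^ l` in the size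
parameter cancels against the number of nodes, so the leading cost is the same on every level. -/

/-- The value `1` or `-1` of a random sign. -/
def boolSign (b : Bool) : ℝ := if b then 1 else -1

/-- Moment generating function of a Rademacher chaos of order two. -/
theorem expect_exp_quadForm_le {n : ℕ} (B : Fin n → Fin n → ℝ) (hB : ∀ i j, B i j = B j i)
    (h : ∑ i, ∑ j, B i j ^ 2 ≤ 1 / 64) :
    𝔼 x : Fin n → Bool, Real.exp (∑ i, ∑ j, B i j * boolSign (x i) * boolSign (x j)) ≤
      Real.exp (∑ i, B i i + 2 * ∑ i, ∑ j, B i j ^ 2) := by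
  induction n with
  | zero => simp
  | succ n ih =>
    set b : Fin n → ℝ := fun i => B 0 i.succ with hb
    set D : Fin n → Fin n → ℝ := fun i j => B i.succ j.succ with hD
    set β := ∑ i, b i ^ 2 with hβ
    set d := ∑ i, ∑ j, D i j ^ 2 with hd
    have hβ0 : 0 ≤ β := Finset.sum_nonneg fun i _ => sq_nonneg _
    have hd0 : 0 ≤ d := Finset.sum_nonneg fun i _ => Finset.sum_nonneg fun j _ => sq_nonneg _
    have hsum : ∑ i, ∑ j, B i j ^ 2 = B 0 0 ^ 2 + 2 * β + d := by
      simp only [Fin.sum_univ_succ, Finset.sum_add_distrib, hβ, hd, hb, hD]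
      simp only [hB (Fin.succ _) 0]
      ring
    set q := ∑ i, ∑ j, D i j * (b i * b j) with hq
    have hbb : ∑ i, ∑ j, (b i * b j) ^ 2 = β ^ 2 := by
      rw [hβ, sq (∑ i, b i ^ 2), Finset.sum_mul_sum]
      simp only [mul_pow]
    have hq2 : q ^ 2 ≤ d * β ^ 2 := by
      rw [← hbb, hq, hd]
      simp only [← Fintype.sum_prod_type']
      exact Finset.sum_mul_sq_le_sq_mul_sq _ _ _
    rw [hsum] at h
    have hd1 : d ≤ 1 / 64 := by nlinarith [sq_nonneg (B 0 0)]
    have hβ1 : β ≤ 1 / 64 := by nlinarith [sq_nonneg (B 0 0)]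
    -- Cauchy-Schwarz with `√d ≤ 1 / 8`. This is what the threshold `1 / 64` is for: it makes the
    -- cross term `q` small enough for the induction to close.
    have hqb : q ≤ β / 8 := by
      refine le_of_sq_le_sq ?_ (by positivity)
      nlinarith [sq_nonneg β]
    -- Averaging over the first sign produces `cosh (2 ℓ) ≤ exp (2 ℓ²)` with `ℓ` linear in the other
    -- signs. This is again a quadratic form, so the remaining coefficients gain the rank-one term
    -- `2 b bᵀ`.
    set B' : Fin n → Fin n → ℝ := fun i j => D i j + 2 * (b i * b j) with hB'
    have hsum' : ∑ i, ∑ j, B' i j ^ 2 = d + 4 * q + 4 * β ^ 2 := by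
      rw [hd, hq, ← hbb]
      simp only [Finset.mul_sum, ← Finset.sum_add_distrib, hB']
      refine Finset.sum_congr rfl fun i _ => Finset.sum_congr rfl fun j _ => by ring
    have htr' : ∑ i, B' i i = ∑ i, D i i + 2 * β := by
      simp only [hβ, Finset.mul_sum, ← Finset.sum_add_distrib, hB']
      refine Finset.sum_congr rfl fun i _ => by ring
    have key := ih B' (fun i j => by simp only [hB', hD, hB i.succ j.succ]; ring)
      (by rw [hsum']; nlinarith [sq_nonneg (B 0 0)])
    rw [hsum', htr'] at key
    have hsplit : 𝔼 x : Fin (n + 1) → Bool,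
        Real.exp (∑ i, ∑ j, B i j * boolSign (x i) * boolSign (x j)) =
        𝔼 x : Fin n → Bool, 𝔼 a : Bool, Real.exp (B 0 0 +
          2 * boolSign a * (∑ i, b i * boolSign (x i)) +
          ∑ i, ∑ j, D i j * boolSign (x i) * boolSign (x j)) := by
      rw [← Finset.expect_product', Finset.univ_product_univ]
      refine (Fintype.expect_equiv ((Equiv.prodComm _ _).trans
        (Fin.consEquiv fun _ : Fin (n + 1) => Bool)) _ _ fun p => ?_).symm
      obtain ⟨x, a⟩ := p
      have ha : boolSign a * boolSign a = 1 := by cases a <;> simp [boolSign]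
      congr 1
      simp only [Equiv.trans_apply, Equiv.prodComm_apply, Prod.swap_prod_mk, Fin.consEquiv_apply,
        Fin.sum_univ_succ, Fin.cons_zero, Fin.cons_succ, Finset.sum_add_distrib, hb, hD,
        hB (Fin.succ _) 0]
      rw [mul_assoc (B 0 0), ha, Finset.mul_sum]
      have : ∀ i : Fin n, 2 * boolSign a * (B 0 i.succ * boolSign (x i)) =
        B 0 i.succ * boolSign a * boolSign (x i) + B 0 i.succ * boolSign (x i) * boolSign a :=
        fun i => by ring
      simp only [this, Finset.sum_add_distrib]
      ring
    rw [hsplit]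
    calc _ ≤ 𝔼 x : Fin n → Bool, Real.exp (B 0 0) *
          Real.exp (∑ i, ∑ j, B' i j * boolSign (x i) * boolSign (x j)) := by
          refine Finset.expect_le_expect fun x _ => ?_
          set ℓ := ∑ i, b i * boolSign (x i) with hℓ
          set Q := ∑ i, ∑ j, D i j * boolSign (x i) * boolSign (x j) with hQ
          have h1 : ∑ i, ∑ j, B' i j * boolSign (x i) * boolSign (x j) = Q + 2 * ℓ ^ 2 := by
            rw [sq, hℓ, Finset.sum_mul_sum, hQ]
            simp only [Finset.mul_sum, ← Finset.sum_add_distrib, hB']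
            refine Finset.sum_congr rfl fun i _ => Finset.sum_congr rfl fun j _ => by ring
          have h2 : 𝔼 a : Bool, Real.exp (B 0 0 + 2 * boolSign a * ℓ + Q) =
              Real.exp (B 0 0) * Real.exp Q * Real.cosh (2 * ℓ) := by
            rw [Fintype.expect_eq_sum_div_card]
            simp [boolSign, Real.exp_add, Real.cosh_eq]
            ring
          rw [h1, h2, Real.exp_add, mul_assoc]
          have := Real.cosh_le_exp_half_sq (2 * ℓ)
          rw [show (2 * ℓ) ^ 2 / 2 = 2 * ℓ ^ 2 by ring] at this
          gcongr
      _ ≤ Real.exp (B 0 0) *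
          Real.exp (∑ i, D i i + 2 * β + 2 * (d + 4 * q + 4 * β ^ 2)) := by
          rw [← Finset.mul_expect]
          gcongr
      _ ≤ _ := by
          rw [← Real.exp_add, hsum, Fin.sum_univ_succ]
          refine Real.exp_le_exp.2 ?_
          change B 0 0 + (∑ i, D i i + 2 * β + 2 * (d + 4 * q + 4 * β ^ 2)) ≤
            B 0 0 + ∑ i, D i i + 2 * (B 0 0 ^ 2 + 2 * β + d)
          nlinarith [sq_nonneg (B 0 0)]

/-! ### Hilbert-Schmidt norm and quadratic forms of operators at sign vectors. -/

/-- The vector of signs given by Booleans. -/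
def signVec {n : ℕ} (x : Fin n → Bool) : Vec n :=
  WithLp.toLp 2 fun a => boolSign (x a)

/-- The square of the Hilbert-Schmidt (Frobenius) norm. -/
noncomputable def hsSq {n : ℕ} (T : Vec n →ₗ[ℝ] Vec n) : ℝ :=
  ∑ i, ‖T (EuclideanSpace.basisFun (Fin n) ℝ i)‖ ^ 2

section HilbertSchmidt

variable {n : ℕ} (T S : Vec n →ₗ[ℝ] Vec n)

theorem hsSq_nonneg : 0 ≤ hsSq T := Finset.sum_nonneg fun _ _ => sq_nonneg _

/-- By Parseval, both sides are the sum of the squared matrix entries with respect to `b` and `c`.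
Independence of the basis and invariance under adjoints follow. -/
theorem sum_norm_sq_eq_sum_norm_adjoint_sq (b c : OrthonormalBasis (Fin n) ℝ (Vec n)) :
    ∑ i, ‖T (b i)‖ ^ 2 = ∑ j, ‖T.adjoint (c j)‖ ^ 2 := by
  calc ∑ i, ‖T (b i)‖ ^ 2 = ∑ i, ∑ j, ‖inner ℝ (c j) (T (b i))‖ ^ 2 := by
        simp only [c.sum_sq_norm_inner_right]
    _ = ∑ j, ∑ i, ‖inner ℝ (b i) (T.adjoint (c j))‖ ^ 2 := by
        rw [Finset.sum_comm]
        simp only [LinearMap.adjoint_inner_right, norm_inner_symm]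
    _ = ∑ j, ‖T.adjoint (c j)‖ ^ 2 := by
        simp only [b.sum_sq_norm_inner_right]

theorem hsSq_adjoint : hsSq T.adjoint = hsSq T :=
  (sum_norm_sq_eq_sum_norm_adjoint_sq T _ _).symm

theorem hsSq_eq_sum (b : OrthonormalBasis (Fin n) ℝ (Vec n)) : hsSq T = ∑ i, ‖T (b i)‖ ^ 2 := by
  rw [sum_norm_sq_eq_sum_norm_adjoint_sq T b (EuclideanSpace.basisFun (Fin n) ℝ), ← hsSq_adjoint]
  rfl

theorem norm_apply_sq_le (x : Vec n) : ‖T x‖ ^ 2 ≤ hsSq T * ‖x‖ ^ 2 := by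
  set b := EuclideanSpace.basisFun (Fin n) ℝ
  rw [← hsSq_adjoint, hsSq, Finset.sum_mul, ← b.sum_sq_norm_inner_right]
  refine Finset.sum_le_sum fun i _ => ?_
  rw [← LinearMap.adjoint_inner_left, ← mul_pow]
  gcongr
  exact norm_inner_le_norm _ _

theorem hsSq_comp_le : hsSq (T ∘ₗ S) ≤ hsSq T * hsSq S := by
  rw [hsSq, hsSq, hsSq, Finset.mul_sum]
  exact Finset.sum_le_sum fun i _ => norm_apply_sq_le T _

theorem trace_adjoint_comp_self : LinearMap.trace ℝ _ (T.adjoint ∘ₗ T) = hsSq T := by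
  rw [LinearMap.trace_eq_sum_inner _ (EuclideanSpace.basisFun (Fin n) ℝ), hsSq]
  refine Finset.sum_congr rfl fun i _ => ?_
  rw [LinearMap.comp_apply, LinearMap.adjoint_inner_right, real_inner_self_eq_norm_sq]

theorem hsSq_smul (a : ℝ) : hsSq (a • T) = a ^ 2 * hsSq T := by
  simp [hsSq, norm_smul, mul_pow, Finset.mul_sum]

theorem signVec_eq_sum (x : Fin n → Bool) :
    signVec x = ∑ i, boolSign (x i) • EuclideanSpace.basisFun (Fin n) ℝ i := by
  conv_lhs => rw [← (EuclideanSpace.basisFun (Fin n) ℝ).sum_repr (signVec x)]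
  rfl

/-- Moment generating function of the quadratic form of an operator at a random sign vector. -/
theorem expect_exp_inner_le (h : hsSq T ≤ 1 / 64) :
    𝔼 x : Fin n → Bool, Real.exp (inner ℝ (signVec x) (T (signVec x))) ≤
      Real.exp (LinearMap.trace ℝ _ T + 2 * hsSq T) := by
  set e := EuclideanSpace.basisFun (Fin n) ℝ with he
  set a : Fin n → Fin n → ℝ := fun i j => inner ℝ (e i) (T (e j)) with ha
  -- Symmetrizing preserves the quadratic form and the trace, and does not increase the
  -- Hilbert-Schmidt norm.
  set B : Fin n → Fin n → ℝ := fun i j => (a i j + a j i) / 2 with hB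
  have hT : ∑ i, ∑ j, a i j ^ 2 = hsSq T := by
    rw [Finset.sum_comm, hsSq]
    refine Finset.sum_congr rfl fun j _ => ?_
    rw [← e.sum_sq_norm_inner_right]
    simp only [ha, Real.norm_eq_abs, sq_abs, he]
  have hBle : ∑ i, ∑ j, B i j ^ 2 ≤ hsSq T := by
    calc ∑ i, ∑ j, B i j ^ 2 ≤ ∑ i, ∑ j, (a i j ^ 2 + a j i ^ 2) / 2 := by
          refine Finset.sum_le_sum fun i _ => Finset.sum_le_sum fun j _ => ?_
          simp only [hB]
          nlinarith [sq_nonneg (a i j - a j i)]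
      _ = hsSq T := by
          simp only [← Finset.sum_div, Finset.sum_add_distrib]
          rw [Finset.sum_comm (f := fun i j => a j i ^ 2), hT]
          ring
  have hq (x : Fin n → Bool) : inner ℝ (signVec x) (T (signVec x)) =
      ∑ i, ∑ j, B i j * boolSign (x i) * boolSign (x j) := by
    have h1 : inner ℝ (signVec x) (T (signVec x)) =
        ∑ i, ∑ j, a i j * boolSign (x i) * boolSign (x j) := by
      rw [signVec_eq_sum]
      rw [map_sum, sum_inner]
      refine Finset.sum_congr rfl fun i _ => ?_
      rw [inner_sum]
      refine Finset.sum_congr rfl fun j _ => ?_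
      simp only [map_smul, inner_smul_left, inner_smul_right, ha, conj_trivial, he]
      ring
    have h2 : ∑ i, ∑ j, a i j * boolSign (x i) * boolSign (x j) =
        ∑ i, ∑ j, a j i * boolSign (x i) * boolSign (x j) := by
      rw [Finset.sum_comm]
      refine Finset.sum_congr rfl fun i _ => Finset.sum_congr rfl fun j _ => by ring
    have h3 : ∑ i, ∑ j, B i j * boolSign (x i) * boolSign (x j) =
        (∑ i, ∑ j, a i j * boolSign (x i) * boolSign (x j) +
          ∑ i, ∑ j, a j i * boolSign (x i) * boolSign (x j)) / 2 := by
      simp only [← Finset.sum_add_distrib, Finset.sum_div, hB]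
      refine Finset.sum_congr rfl fun i _ => Finset.sum_congr rfl fun j _ => by ring
    rw [h1, h3, ← h2]
    ring
  have htr : LinearMap.trace ℝ _ T = ∑ i, B i i := by
    rw [LinearMap.trace_eq_sum_inner _ e]
    refine Finset.sum_congr rfl fun i _ => ?_
    simp only [hB, ha]
    ring
  simp only [hq, htr]
  refine (expect_exp_quadForm_le B (fun i j => ?_) (hBle.trans h)).trans ?_
  · simp only [hB]
    ring
  · gcongr

end HilbertSchmidt

/-! ### Nuclear norm bounds by duality. -/

section NuclearBound

variable {n : ℕ}

/-- A finite family of vectors satisfying Bessel's inequality. -/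
def IsBessel (u : Fin n → Vec n) : Prop :=
  ∀ x, ∑ i, inner ℝ (u i) x ^ 2 ≤ ‖x‖ ^ 2

/-- The dual formulation of the statement that the nuclear norm of `T` is at most `N`. -/
def NuclearBound (T : Vec n →ₗ[ℝ] Vec n) (N : ℝ) : Prop :=
  ∀ u v : Fin n → Vec n, IsBessel u → IsBessel v → ∑ i, inner ℝ (u i) (T (v i)) ≤ N

theorem NuclearBound.mono {T : Vec n →ₗ[ℝ] Vec n} {N N' : ℝ} (h : NuclearBound T N)
    (hN : N ≤ N') : NuclearBound T N' :=
  fun u v hu hv => (h u v hu hv).trans hN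

theorem NuclearBound.add {T S : Vec n →ₗ[ℝ] Vec n} {N M : ℝ} (hT : NuclearBound T N)
    (hS : NuclearBound S M) : NuclearBound (T + S) (N + M) := by
  intro u v hu hv
  simp only [LinearMap.add_apply, inner_add_right, Finset.sum_add_distrib]
  exact add_le_add (hT u v hu hv) (hS u v hu hv)

theorem NuclearBound.zero : NuclearBound (0 : Vec n →ₗ[ℝ] Vec n) 0 := by
  intro u v _ _
  simp

/-- By symmetry `P` moves onto the test family `u`, which stays Bessel because `P` is a contraction.
-/
theorem NuclearBound.comp_left {T P : Vec n →ₗ[ℝ] Vec n} {N : ℝ} (hT : NuclearBound T N)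
    (hP : P.IsSymmetric) (hP1 : ∀ x, ‖P x‖ ≤ ‖x‖) : NuclearBound (P ∘ₗ T) N := by
  intro u v hu hv
  have := hT (fun i => P (u i)) v (fun x => ?_) hv
  · simpa only [LinearMap.comp_apply, ← hP _ (T _)] using this
  · simp only [hP _ x]
    exact (hu _).trans (by gcongr; exact hP1 x)

theorem isBessel_orthonormalBasis (b : OrthonormalBasis (Fin n) ℝ (Vec n)) : IsBessel b := by
  intro x
  rw [← b.sum_sq_norm_inner_right]
  simp

/-- Expand each `v i` in the basis `e` and apply Cauchy-Schwarz over `i` for each basis vector. For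
right singular vectors the bound is the nuclear norm. -/
theorem nuclearBound_sum_norm (T : Vec n →ₗ[ℝ] Vec n) (e : OrthonormalBasis (Fin n) ℝ (Vec n)) :
    NuclearBound T (∑ j, ‖T (e j)‖) := by
  intro u v hu hv
  have h1 (i : Fin n) : inner ℝ (u i) (T (v i)) =
      ∑ j, inner ℝ (v i) (e j) * inner ℝ (u i) (T (e j)) := by
    conv_lhs => rw [← e.sum_repr' (v i)]
    simp only [map_sum, map_smul, inner_sum, inner_smul_right, real_inner_comm]
  simp only [h1]
  rw [Finset.sum_comm]
  refine Finset.sum_le_sum fun j _ => le_of_sq_le_sq ?_ (norm_nonneg _)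
  refine (Finset.sum_mul_sq_le_sq_mul_sq _ _ _).trans ?_
  have h2 := hv (e j)
  rw [e.orthonormal.1 j, one_pow] at h2
  exact (mul_le_mul h2 (hu _) (Finset.sum_nonneg fun _ _ => sq_nonneg _) zero_le_one).trans_eq
    (one_mul _)

/-- The right singular vectors of an operator. -/
theorem exists_orthonormalBasis_adjoint_comp (T : Vec n →ₗ[ℝ] Vec n) :
    ∃ e : OrthonormalBasis (Fin n) ℝ (Vec n), ∀ i,
      (T.adjoint ∘ₗ T) (e i) = (T.singularValues i ^ 2) • e i ∧ ‖T (e i)‖ = T.singularValues i := by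
  have hn : Module.finrank ℝ (Vec n) = n := by simp
  refine ⟨T.isSymmetric_adjoint_comp_self.eigenvectorBasis hn, fun i => ?_⟩
  have h1 := T.isSymmetric_adjoint_comp_self.apply_eigenvectorBasis hn i
  rw [← T.sq_singularValues_fin hn i] at h1
  set e := T.isSymmetric_adjoint_comp_self.eigenvectorBasis hn
  refine ⟨h1, ?_⟩
  have h2 : ‖T (e i)‖ ^ 2 = T.singularValues i ^ 2 := by
    rw [← real_inner_self_eq_norm_sq, ← LinearMap.adjoint_inner_right, ← LinearMap.comp_apply, h1]
    simp [inner_smul_right]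
  exact (sq_eq_sq₀ (norm_nonneg _) (T.singularValues_nonneg i)).1 h2

theorem nuclearBound_nuclearNorm (A : Matrix (Fin n) (Fin n) ℝ) :
    NuclearBound (Matrix.toEuclideanLin A) (nuclearNorm A) := by
  obtain ⟨e, he⟩ := exists_orthonormalBasis_adjoint_comp (Matrix.toEuclideanLin A)
  have := nuclearBound_sum_norm (Matrix.toEuclideanLin A) e
  simpa only [he, nuclearNorm] using this

/-- Two applications of Cauchy-Schwarz: `a²` is the geometric mean of `a` and `a³`, and `a³` that of
`a²` and `a⁴`. -/
theorem sum_sq_cube_le {ι : Type*} [Fintype ι] (a : ι → ℝ) (ha : ∀ i, 0 ≤ a i) :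
    (∑ i, a i ^ 2) ^ 3 ≤ (∑ i, a i) ^ 2 * ∑ i, (a i ^ 2) ^ 2 := by
  have h1 : (∑ i, a i ^ 2) ^ 2 ≤ (∑ i, a i) * ∑ i, a i ^ 3 :=
    Finset.sum_sq_le_sum_mul_sum_of_sq_le_mul _ (fun i _ => ha i) (fun i _ => pow_nonneg (ha i) 3)
      fun i _ => by ring_nf; rfl
  have h2 : (∑ i, a i ^ 3) ^ 2 ≤ (∑ i, a i ^ 2) * ∑ i, (a i ^ 2) ^ 2 :=
    Finset.sum_sq_le_sum_mul_sum_of_sq_le_mul _ (fun i _ => sq_nonneg _) (fun i _ => sq_nonneg _)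
      fun i _ => by ring_nf; rfl
  rcases (Finset.sum_nonneg fun i _ => sq_nonneg (a i) : 0 ≤ ∑ i, a i ^ 2).eq_or_lt with h0 | h0
  · rw [← h0, zero_pow (by norm_num)]
    exact mul_nonneg (sq_nonneg _) (Finset.sum_nonneg fun _ _ => sq_nonneg _)
  · refine le_of_mul_le_mul_left ?_ h0
    calc (∑ i, a i ^ 2) * (∑ i, a i ^ 2) ^ 3 = ((∑ i, a i ^ 2) ^ 2) ^ 2 := by ring
      _ ≤ ((∑ i, a i) * ∑ i, a i ^ 3) ^ 2 := by gcongr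
      _ = (∑ i, a i) ^ 2 * (∑ i, a i ^ 3) ^ 2 := by ring
      _ ≤ (∑ i, a i) ^ 2 * ((∑ i, a i ^ 2) * ∑ i, (a i ^ 2) ^ 2) := by gcongr
      _ = _ := by ring

/-- Test the dual bound on the left and right singular vectors. Since `0⁻¹ = 0`, a vanishing
singular value just gives a zero vector in the left family. -/
theorem NuclearBound.sum_singularValues_le {T : Vec n →ₗ[ℝ] Vec n} {N : ℝ}
    (hT : NuclearBound T N) : ∑ i : Fin n, T.singularValues i ≤ N := by
  obtain ⟨e, he⟩ := exists_orthonormalBasis_adjoint_comp T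
  set σ : Fin n → ℝ := fun i => T.singularValues i with hσ
  have hin (i j : Fin n) : inner ℝ (T (e i)) (T (e j)) = if i = j then σ i ^ 2 else 0 := by
    rw [← LinearMap.adjoint_inner_right, ← LinearMap.comp_apply, (he j).1, inner_smul_right,
      orthonormal_iff_ite.1 e.orthonormal]
    split_ifs with h <;> simp [h, hσ]
  have hb : IsBessel fun i => (σ i)⁻¹ • T (e i) := by
    intro x
    set c : Fin n → ℝ := fun i => inner ℝ ((σ i)⁻¹ • T (e i)) x with hc
    -- `y` is the projection of `x` to the span of the left singular vectors; Bessel's inequality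
    -- follows from `‖y‖² ≤ ⟪y, x⟫ ≤ ‖y‖ ‖x‖`.
    set y := ∑ i, c i • ((σ i)⁻¹ • T (e i)) with hy
    have h1 : inner ℝ y x = ∑ i, c i ^ 2 := by
      rw [hy, sum_inner]
      exact Finset.sum_congr rfl fun i _ => by rw [real_inner_smul_left, sq]
    have h2 : ‖y‖ ^ 2 ≤ ∑ i, c i ^ 2 := by
      rw [← real_inner_self_eq_norm_sq, hy, sum_inner]
      refine Finset.sum_le_sum fun i _ => ?_
      simp only [inner_sum, inner_smul_left, inner_smul_right, hin, conj_trivial]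
      simp only [mul_ite, mul_zero, Finset.sum_ite_eq, Finset.mem_univ, if_true]
      rcases eq_or_ne (σ i) 0 with h | h
      · simp [h, sq_nonneg]
      · exact le_of_eq (by field_simp)
    have h3 := real_inner_le_norm y x
    rw [h1] at h3
    have h4 : (0 : ℝ) ≤ ∑ i, c i ^ 2 := Finset.sum_nonneg fun i _ => sq_nonneg _
    change ∑ i, c i ^ 2 ≤ _
    rcases h4.eq_or_lt with h0 | h0
    · rw [← h0]; positivity
    · have h5 : (∑ i, c i ^ 2) ^ 2 ≤ (∑ i, c i ^ 2) * ‖x‖ ^ 2 := by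
        calc _ ≤ (‖y‖ * ‖x‖) ^ 2 := by gcongr
          _ = ‖y‖ ^ 2 * ‖x‖ ^ 2 := by ring
          _ ≤ _ := by gcongr
      rw [sq] at h5
      exact le_of_mul_le_mul_left h5 h0
  refine le_trans (Finset.sum_le_sum fun i _ => ?_) (hT _ e hb (isBessel_orthonormalBasis e))
  rw [inner_smul_left, hin, if_pos rfl, conj_trivial]
  change σ i ≤ _
  rcases eq_or_ne (σ i) 0 with h | h
  · simp [h]
  · exact le_of_eq (by field_simp)

/-- Hölder's inequality between the Schatten norms with exponents `1`, `2` and `4`. -/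
theorem NuclearBound.hsSq_cube_le {T : Vec n →ₗ[ℝ] Vec n} {N : ℝ} (hT : NuclearBound T N) :
    hsSq T ^ 3 ≤ N ^ 2 * hsSq (T.adjoint ∘ₗ T) := by
  obtain ⟨e, he⟩ := exists_orthonormalBasis_adjoint_comp T
  rw [hsSq_eq_sum T e, hsSq_eq_sum _ e]
  simp only [he, norm_smul, e.orthonormal.1, mul_one, norm_pow, Real.norm_eq_abs, sq_abs]
  refine (sum_sq_cube_le (fun i : Fin n => T.singularValues i) fun i => T.singularValues_nonneg i).trans ?_
  have h0 : (0 : ℝ) ≤ ∑ i : Fin n, T.singularValues i :=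
    Finset.sum_nonneg fun i _ => T.singularValues_nonneg i
  gcongr
  exact hT.sum_singularValues_le

end NuclearBound

/-! ### Decay of the Hilbert-Schmidt norm under removal of random range directions. -/

section Deflation

variable {n : ℕ}

/-- The projection onto the orthogonal complement of `w`, if `w` is a unit vector or zero. -/
noncomputable def rejection (w : Vec n) : Vec n →ₗ[ℝ] Vec n :=
  LinearMap.id - (innerₛₗ ℝ w).smulRight w

theorem rejection_apply (w x : Vec n) : rejection w x = x - inner ℝ w x • w := by
  simp [rejection]

theorem isSymmetric_rejection (w : Vec n) : (rejection w).IsSymmetric := by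
  intro x y
  simp only [rejection_apply, inner_sub_left, inner_sub_right, inner_smul_left, inner_smul_right,
    conj_trivial, real_inner_comm w x]
  ring

theorem norm_rejection_sq {w : Vec n} (hw : w = 0 ∨ ‖w‖ = 1) (x : Vec n) :
    ‖rejection w x‖ ^ 2 = ‖x‖ ^ 2 - inner ℝ w x ^ 2 := by
  rw [rejection_apply, norm_sub_sq_real, inner_smul_right, norm_smul, Real.norm_eq_abs, mul_pow,
    sq_abs, real_inner_comm]
  rcases hw with rfl | hw
  · simp
  · rw [hw]; ring

theorem norm_rejection_le {w : Vec n} (hw : w = 0 ∨ ‖w‖ = 1) (x : Vec n) :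
    ‖rejection w x‖ ≤ ‖x‖ := by
  refine le_of_sq_le_sq ?_ (norm_nonneg _)
  rw [norm_rejection_sq hw]
  linarith [sq_nonneg (inner ℝ w x)]

/-- The vector `x`, scaled to unit length unless it is zero. -/
noncomputable def unitize (x : Vec n) : Vec n := ‖x‖⁻¹ • x

theorem unitize_eq_zero_or_norm (x : Vec n) : unitize x = 0 ∨ ‖unitize x‖ = 1 := by
  rcases eq_or_ne x 0 with rfl | h
  · simp [unitize]
  · right
    rw [unitize, norm_smul, norm_inv, norm_norm, inv_mul_cancel₀ (norm_ne_zero_iff.2 h)]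

/-- The part of `T` whose range is orthogonal to `T s`. -/
noncomputable def deflate (T : Vec n →ₗ[ℝ] Vec n) (s : Vec n) : Vec n →ₗ[ℝ] Vec n :=
  rejection (unitize (T s)) ∘ₗ T

/-- Pythagoras on each column: the loss is `‖Tᵀ w‖²` for the normalized `w` along `T s`. If `T s =
0`, the quotient is zero by convention, as it should be. -/
theorem hsSq_deflate (T : Vec n →ₗ[ℝ] Vec n) (s : Vec n) :
    hsSq (deflate T s) = hsSq T - ‖(T.adjoint ∘ₗ T) s‖ ^ 2 / ‖T s‖ ^ 2 := by
  set w := unitize (T s) with hw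
  have h1 : hsSq (deflate T s) = hsSq T - ‖T.adjoint w‖ ^ 2 := by
    simp only [hsSq, deflate, LinearMap.comp_apply, norm_rejection_sq (unitize_eq_zero_or_norm _),
      Finset.sum_sub_distrib]
    rw [← (EuclideanSpace.basisFun (Fin n) ℝ).sum_sq_norm_inner_left (T.adjoint w)]
    simp only [LinearMap.adjoint_inner_left, Real.norm_eq_abs, sq_abs, hw]
  rw [h1, hw, unitize, map_smul, norm_smul, mul_pow, norm_inv, norm_norm, inv_pow]
  simp only [LinearMap.comp_apply]
  ring

/-- The function used to measure the decrease of the Hilbert-Schmidt norm under deflation. -/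
noncomputable def residualPotential (N φ : ℝ) : ℝ :=
  if φ ≤ 0 then 0 else Real.exp (-(8 * N ^ 2 / φ))

theorem residualPotential_nonneg (N φ : ℝ) : 0 ≤ residualPotential N φ := by
  unfold residualPotential
  split_ifs <;> positivity

theorem residualPotential_le_one (N φ : ℝ) : residualPotential N φ ≤ 1 := by
  unfold residualPotential
  split_ifs with h
  · exact zero_le_one
  · rw [Real.exp_le_one_iff]
    push Not at h
    have : 0 ≤ 8 * N ^ 2 / φ := by positivity
    linarith

/-- Convexity of the reciprocal gives `1 / (φ - d) ≥ 1 / φ + d / φ²`, and the Hölder bound `h` turns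
`N² d / φ²` into at least `d φ / ψ`. -/
theorem residualPotential_sub_le {N φ ψ d : ℝ} (hφ : 0 < φ) (hψ : 0 < ψ)
    (h : φ ^ 3 ≤ N ^ 2 * ψ) (hd : 0 ≤ d) :
    residualPotential N (φ - d) ≤ Real.exp (-(8 * (d * φ / ψ))) * residualPotential N φ := by
  unfold residualPotential
  rw [if_neg hφ.not_ge]
  split_ifs with h1
  · positivity
  · push Not at h1
    rw [← Real.exp_add, Real.exp_le_exp]
    have h2 : 1 / φ + d / φ ^ 2 ≤ 1 / (φ - d) := by
      rw [div_add_div _ _ hφ.ne' (by positivity), div_le_div_iff₀ (by positivity) h1]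
      nlinarith [mul_nonneg hφ.le (sq_nonneg d)]
    have h3 : d * φ / ψ ≤ N ^ 2 * (d / φ ^ 2) := by
      rw [← mul_div_assoc, div_le_div_iff₀ hψ (by positivity)]
      nlinarith [mul_le_mul_of_nonneg_left h hd]
    have h4 := mul_le_mul_of_nonneg_left h2 (sq_nonneg N)
    have h5 : N ^ 2 * (1 / φ + d / φ ^ 2) = N ^ 2 / φ + N ^ 2 * (d / φ ^ 2) := by ring
    have h6 : N ^ 2 * (1 / (φ - d)) = N ^ 2 / (φ - d) := by ring
    have h7 : 8 * N ^ 2 / φ = 8 * (N ^ 2 / φ) := by ring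
    have h8 : 8 * N ^ 2 / (φ - d) = 8 * (N ^ 2 / (φ - d)) := by ring
    linarith

/-- The exponent is the quadratic form of `(a / hsSq T) • TᵀT`, which has trace `a` and squared
Hilbert-Schmidt norm at most `a² ≤ 1 / 64`. -/
theorem expect_exp_norm_sq_le (T : Vec n →ₗ[ℝ] Vec n) (hT : 0 < hsSq T) (a : ℝ)
    (ha : |a| ≤ 1 / 8) :
    𝔼 x : Fin n → Bool, Real.exp (a * (‖T (signVec x)‖ ^ 2 / hsSq T)) ≤
      Real.exp (a + 1 / 32) := by
  set W := (a / hsSq T) • (T.adjoint ∘ₗ T) with hW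
  have ha2 : a ^ 2 ≤ 1 / 64 := by
    rw [← sq_abs]
    nlinarith [abs_nonneg a]
  have h1 : hsSq W ≤ a ^ 2 := by
    rw [hW, hsSq_smul, div_pow, div_mul_eq_mul_div, div_le_iff₀ (by positivity)]
    refine mul_le_mul_of_nonneg_left ?_ (sq_nonneg a)
    refine (hsSq_comp_le _ _).trans_eq ?_
    rw [hsSq_adjoint, sq]
  have h2 : LinearMap.trace ℝ _ W = a := by
    rw [hW, map_smul, trace_adjoint_comp_self, smul_eq_mul, div_mul_cancel₀ _ hT.ne']
  have h3 := expect_exp_inner_le W (h1.trans ha2)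
  rw [h2] at h3
  refine le_trans (le_of_eq ?_) (h3.trans (Real.exp_le_exp.2 (by linarith)))
  refine Finset.expect_congr rfl fun x _ => ?_
  rw [hW, LinearMap.smul_apply, inner_smul_right, LinearMap.comp_apply,
    LinearMap.adjoint_inner_right, real_inner_self_eq_norm_sq]
  congr 1
  ring

/-- The potential is multiplied by at most `exp (-8 Z / X)`, where `X` and `Z` are `‖T s‖²` and
`‖TᵀT s‖²` divided by `hsSq T` and `hsSq (TᵀT)`. It remains to see that `X` is rarely large and `Z`
rarely small. -/
theorem expect_residualPotential_deflate_le {T : Vec n →ₗ[ℝ] Vec n} {N : ℝ}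
    (hT : NuclearBound T N) :
    𝔼 x : Fin n → Bool, residualPotential N (hsSq (deflate T (signVec x))) ≤
      Real.exp (-(1 / 20)) * residualPotential N (hsSq T) := by
  set φ := hsSq T with hφ
  set W := T.adjoint ∘ₗ T with hW
  set ψ := hsSq W with hψ
  rcases (hsSq_nonneg T).eq_or_lt with h0 | hφ0
  · have hle (x : Fin n → Bool) : residualPotential N (hsSq (deflate T (signVec x))) = 0 := by
      rw [residualPotential, if_pos]
      rw [hsSq_deflate, ← h0, zero_sub, neg_nonpos]
      positivity
    simp only [hle, Finset.expect_const_zero]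
    exact mul_nonneg (Real.exp_nonneg _) (residualPotential_nonneg _ _)
  have hcube : φ ^ 3 ≤ N ^ 2 * ψ := hT.hsSq_cube_le
  have hψ0 : 0 < ψ := by
    have := hsSq_nonneg W
    have h3 : 0 < φ ^ 3 := by positivity
    by_contra hneg
    have : ψ = 0 := le_antisymm (not_lt.1 hneg) this
    rw [this, mul_zero] at hcube
    linarith
  set X : (Fin n → Bool) → ℝ := fun x => ‖T (signVec x)‖ ^ 2 / φ with hX
  set Z : (Fin n → Bool) → ℝ := fun x => ‖W (signVec x)‖ ^ 2 / ψ with hZ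
  have hX0 (x) : 0 ≤ X x := by simp only [hX]; positivity
  have hZ0 (x) : 0 ≤ Z x := by simp only [hZ]; positivity
  -- Split at `X = 64`: below it `8 Z / X ≥ Z / 8`, above it `X / 64` already exceeds `1`. This
  -- decouples `X` from `Z`, which are dependent.
  have hpt (x : Fin n → Bool) : residualPotential N (hsSq (deflate T (signVec x))) ≤
      (X x / 64 + Real.exp (-(1 / 8) * Z x)) * residualPotential N φ := by
    rw [hsSq_deflate]
    refine (residualPotential_sub_le hφ0 hψ0 hcube (by positivity)).trans ?_
    refine mul_le_mul_of_nonneg_right ?_ (residualPotential_nonneg _ _)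
    have hY : ‖W (signVec x)‖ ^ 2 / ‖T (signVec x)‖ ^ 2 * φ / ψ = Z x / X x := by
      simp only [hZ, hX]
      rw [div_div_div_eq]
      ring
    rw [hY]
    rcases (hX0 x).eq_or_lt with h1 | h1
    · have hT0 : T (signVec x) = 0 :=
        (by simpa [hX] using h1.symm : T (signVec x) = 0 ∨ φ = 0).resolve_right hφ0.ne'
      have : Z x = 0 := by simp [hZ, hW, hT0]
      rw [this, ← h1]
      simp
    rcases le_or_gt (X x) 64 with h2 | h2
    · have : Real.exp (-(8 * (Z x / X x))) ≤ Real.exp (-(1 / 8) * Z x) := by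
        rw [Real.exp_le_exp]
        have : Z x / 64 ≤ Z x / X x := div_le_div_of_nonneg_left (hZ0 x) h1 h2
        linarith
      have := hX0 x
      linarith
    · have : Real.exp (-(8 * (Z x / X x))) ≤ 1 := by
        rw [Real.exp_le_one_iff, neg_nonpos]
        exact mul_nonneg (by norm_num) (div_nonneg (hZ0 x) h1.le)
      have := Real.exp_nonneg (-(1 / 8) * Z x)
      linarith
  have hEZ : 𝔼 x, Real.exp (-(1 / 8) * Z x) ≤ 32 / 35 := by
    refine (expect_exp_norm_sq_le W hψ0 (-(1 / 8)) (by norm_num [abs_of_pos])).trans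
      ?_
    have h := Real.add_one_le_exp (3 / 32 : ℝ)
    rw [show -(1 / 8 : ℝ) + 1 / 32 = -(3 / 32) by norm_num, Real.exp_neg,
      inv_le_comm₀ (Real.exp_pos _) (by norm_num)]
    linarith
  -- A crude bound suffices, read off the exponential moment through `1 + X / 8 ≤ exp (X / 8)`.
  have hEX : 𝔼 x, X x ≤ 40 / 27 := by
    have h1 := expect_exp_norm_sq_le T hφ0 (1 / 8) (by norm_num [abs_of_pos])
    have h2 : Real.exp (1 / 8 + 1 / 32) ≤ 32 / 27 := by
      have h := Real.add_one_le_exp (-(5 / 32) : ℝ)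
      rw [show (1 / 8 : ℝ) + 1 / 32 = 5 / 32 by norm_num]
      rw [Real.exp_neg] at h
      rw [← inv_inv (Real.exp _), inv_le_comm₀ (by positivity) (by norm_num)]
      linarith
    have h3 : 𝔼 x, (1 / 8 * X x + 1) ≤ 32 / 27 :=
      (Finset.expect_le_expect fun x _ => Real.add_one_le_exp _).trans (h1.trans h2)
    rw [Finset.expect_add_distrib, ← Finset.mul_expect, Fintype.expect_const] at h3
    linarith
  calc _ ≤ 𝔼 x, (X x / 64 + Real.exp (-(1 / 8) * Z x)) * residualPotential N φ :=
        Finset.expect_le_expect fun x _ => hpt x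
    _ = ((𝔼 x, X x) / 64 + 𝔼 x, Real.exp (-(1 / 8) * Z x)) * residualPotential N φ := by
        rw [← Finset.expect_mul, Finset.expect_add_distrib, Finset.expect_div]
    _ ≤ _ := by
        refine mul_le_mul_of_nonneg_right ?_ (residualPotential_nonneg _ _)
        -- Numerically, `40 / (27 * 64) + 32 / 35 < 19 / 20 ≤ exp (-1 / 20)`.
        have := Real.add_one_le_exp (-(1 / 20) : ℝ)
        linarith

/-- Deflation with several vectors, one after the other. -/
noncomputable def deflateSeq : {q : ℕ} → (Vec n →ₗ[ℝ] Vec n) → (Fin q → Fin n → Bool) →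
    (Vec n →ₗ[ℝ] Vec n)
  | 0, T, _ => T
  | _ + 1, T, S => deflateSeq (deflate T (signVec (S 0))) (Fin.tail S)

/-- The sign vectors are independent and deflation keeps the nuclear bound `N`, so the one-step
factors multiply. -/
theorem expect_residualPotential_deflateSeq_le (q : ℕ) {T : Vec n →ₗ[ℝ] Vec n} {N : ℝ}
    (hT : NuclearBound T N) :
    𝔼 S : Fin q → Fin n → Bool, residualPotential N (hsSq (deflateSeq T S)) ≤
      Real.exp (-(q / 20)) * residualPotential N (hsSq T) := by
  induction q generalizing T with
  | zero => simp [deflateSeq]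
  | succ q ih =>
    have hsplit : 𝔼 S : Fin (q + 1) → Fin n → Bool, residualPotential N (hsSq (deflateSeq T S)) =
        𝔼 x : Fin n → Bool, 𝔼 S : Fin q → Fin n → Bool,
          residualPotential N (hsSq (deflateSeq (deflate T (signVec x)) S)) := by
      rw [← Finset.expect_product', Finset.univ_product_univ]
      exact (Fintype.expect_equiv (Fin.consEquiv fun _ : Fin (q + 1) => Fin n → Bool) _ _
        fun p => rfl).symm
    rw [hsplit]
    calc _ ≤ 𝔼 x : Fin n → Bool, Real.exp (-(q / 20)) *
          residualPotential N (hsSq (deflate T (signVec x))) :=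
          Finset.expect_le_expect fun x _ => ih (hT.comp_left (isSymmetric_rejection _)
            (norm_rejection_le (unitize_eq_zero_or_norm _)))
      _ ≤ Real.exp (-(q / 20)) * (Real.exp (-(1 / 20)) * residualPotential N (hsSq T)) := by
          rw [← Finset.mul_expect]
          exact mul_le_mul_of_nonneg_left (expect_residualPotential_deflate_le hT)
            (Real.exp_nonneg _)
      _ = _ := by
          rw [← mul_assoc, ← Real.exp_add]
          congr 2
          push_cast
          ring

/-- Links sequential deflation with the sketch: everything removed lies in the column space of `T
S`, which `1 - Q Qᵀ` annihilates. -/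
theorem sub_deflateSeq_mem_span {q : ℕ} (T : Vec n →ₗ[ℝ] Vec n) (S : Fin q → Fin n → Bool)
    (x : Vec n) :
    T x - deflateSeq T S x ∈ Submodule.span ℝ (Set.range fun j => T (signVec (S j))) := by
  induction q generalizing T with
  | zero => simp [deflateSeq]
  | succ q ih =>
    set V := Submodule.span ℝ (Set.range fun j => T (signVec (S j)))
    have hmem (j) : T (signVec (S j)) ∈ V := Submodule.subset_span ⟨j, rfl⟩
    have hdef (y : Vec n) : T y - deflate T (signVec (S 0)) y ∈ V := by
      rw [deflate, LinearMap.comp_apply, rejection_apply, sub_sub_cancel, unitize]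
      exact V.smul_mem _ (V.smul_mem _ (hmem 0))
    have h2 := Submodule.span_le (p := V).2 (by
      rintro _ ⟨j, rfl⟩
      have := V.sub_mem (hmem j.succ) (hdef (signVec (S j.succ)))
      rwa [sub_sub_cancel] at this) (ih (deflate T (signVec (S 0))) (Fin.tail S))
    have h3 := V.add_mem (hdef x) h2
    rwa [sub_add_sub_cancel] at h3

end Deflation

/-! ### The projection `1 - Q Qᵀ` for a Gram-Schmidt family. -/

section Projection

variable {n q : ℕ}

/-- The map `1 - Q Qᵀ` for a matrix with columns `Q`. -/
noncomputable def residualMap (Q : Fin q → Vec n) : Vec n →ₗ[ℝ] Vec n :=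
  LinearMap.id - ∑ a, (innerₛₗ ℝ (Q a)).smulRight (Q a)

theorem residualMap_apply (Q : Fin q → Vec n) (x : Vec n) :
    residualMap Q x = x - ∑ a, inner ℝ (Q a) x • Q a := by
  simp [residualMap, LinearMap.sum_apply]

theorem isSymmetric_residualMap (Q : Fin q → Vec n) : (residualMap Q).IsSymmetric := by
  intro x y
  simp only [residualMap_apply, inner_sub_left, inner_sub_right, inner_sum, sum_inner,
    inner_smul_left, inner_smul_right, conj_trivial]
  congr 1
  refine Finset.sum_congr rfl fun a _ => ?_
  rw [real_inner_comm x (Q a)]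
  ring

/-- It suffices to check the columns of `Q`: they are orthogonal and either of unit length or zero,
the latter when `f` is linearly dependent. -/
theorem residualMap_gramSchmidtNormed_eq_zero (f : Fin q → Vec n) {x : Vec n}
    (hx : x ∈ Submodule.span ℝ (Set.range f)) :
    residualMap (gramSchmidtNormed ℝ f) x = 0 := by
  rw [← span_gramSchmidt, ← span_gramSchmidtNormed_range] at hx
  set Q := gramSchmidtNormed ℝ f with hQ
  suffices h : Submodule.span ℝ (Set.range Q) ≤ LinearMap.ker (residualMap Q) from h hx
  rw [Submodule.span_le]
  rintro _ ⟨b, rfl⟩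
  rw [SetLike.mem_coe, LinearMap.mem_ker, residualMap_apply, Finset.sum_eq_single b]
  · by_cases h : Q b = 0
    · simp [h]
    · rw [real_inner_self_eq_norm_sq, hQ, gramSchmidtNormed_unit_length' h]
      simp
  · intro a _ hab
    simp [hQ, gramSchmidtNormed, inner_smul_left, inner_smul_right, gramSchmidt_orthogonal ℝ f hab]
  · simp

theorem residualMap_gramSchmidtNormed_idem (f : Fin q → Vec n) (x : Vec n) :
    residualMap (gramSchmidtNormed ℝ f) (residualMap (gramSchmidtNormed ℝ f) x) =
      residualMap (gramSchmidtNormed ℝ f) x := by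
  have h : ∑ a, inner ℝ (gramSchmidtNormed ℝ f a) x • gramSchmidtNormed ℝ f a ∈
      Submodule.span ℝ (Set.range f) := by
    rw [← span_gramSchmidt, ← span_gramSchmidtNormed_range]
    exact Submodule.sum_mem _ fun a _ => Submodule.smul_mem _ _ (Submodule.subset_span ⟨a, rfl⟩)
  conv_lhs => rw [residualMap_apply _ x]
  rw [map_sub, residualMap_gramSchmidtNormed_eq_zero f h, sub_zero]

theorem norm_residualMap_gramSchmidtNormed_le (f : Fin q → Vec n) (x : Vec n) :
    ‖residualMap (gramSchmidtNormed ℝ f) x‖ ≤ ‖x‖ := by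
  set R := residualMap (gramSchmidtNormed ℝ f) with hR
  have h1 : ‖R x‖ ^ 2 ≤ ‖R x‖ * ‖x‖ := by
    rw [← real_inner_self_eq_norm_sq, isSymmetric_residualMap _ x,
      residualMap_gramSchmidtNormed_idem, real_inner_comm]
    exact real_inner_le_norm _ _
  rcases (norm_nonneg (R x)).eq_or_lt with h | h
  · rw [← h]; positivity
  · rw [sq] at h1
    exact le_of_mul_le_mul_left h1 h

theorem trace_comp_residualMap (T : Vec n →ₗ[ℝ] Vec n) (Q : Fin q → Vec n) :
    LinearMap.trace ℝ _ (T ∘ₗ residualMap Q) =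
      LinearMap.trace ℝ _ T - ∑ a, inner ℝ (Q a) (T (Q a)) := by
  set e := EuclideanSpace.basisFun (Fin n) ℝ
  rw [LinearMap.trace_eq_sum_inner _ e, LinearMap.trace_eq_sum_inner _ e]
  simp only [LinearMap.comp_apply, residualMap_apply, map_sub, map_sum, map_smul, inner_sub_right,
    inner_sum, inner_smul_right, Finset.sum_sub_distrib]
  rw [Finset.sum_comm]
  simp only [e.sum_inner_mul_inner]

end Projection

/-! ### Failure probability of a single Hutch++ run. -/

section HutchPP

variable {n q : ℕ}

/-- The operator `(1 - Q Qᵀ) T (1 - Q Qᵀ)` of Hutch++ for a sketch `S`. -/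
noncomputable def sketchResidual (T : Vec n →ₗ[ℝ] Vec n) (S : SignSeed n q) : Vec n →ₗ[ℝ] Vec n :=
  residualMap (gramSchmidtNormed ℝ fun j => T (S.vec j)) ∘ₗ T ∘ₗ
    residualMap (gramSchmidtNormed ℝ fun j => T (S.vec j))

/-- The value that Hutch++ computes for an operator. -/
noncomputable def hutchValue (T : Vec n →ₗ[ℝ] Vec n) (seed : HutchSeed n q) : ℝ :=
  let Q : Fin q → Vec n := gramSchmidtNormed ℝ fun j => T (seed.1.vec j)
  let W : Fin q → Vec n := fun j => seed.2.vec j - ∑ a, inner ℝ (Q a) (seed.2.vec j) • Q a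
  ∑ j, inner ℝ (Q j) (T (Q j)) + (1 / (q : ℝ)) * ∑ j, inner ℝ (W j) (T (W j))

theorem hsSq_sketchResidual_le (T : Vec n →ₗ[ℝ] Vec n) (S : SignSeed n q) :
    hsSq (sketchResidual T S) ≤ hsSq (deflateSeq T S) := by
  set f : Fin q → Vec n := fun j => T (S.vec j) with hf
  set R := residualMap (gramSchmidtNormed ℝ f) with hR
  have hRT (x : Vec n) : R (T x) = R (deflateSeq T S x) := by
    have h := residualMap_gramSchmidtNormed_eq_zero f (sub_deflateSeq_mem_span T S x)
    rwa [map_sub, sub_eq_zero] at h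
  have hle (A : Vec n →ₗ[ℝ] Vec n) : hsSq (R ∘ₗ A) ≤ hsSq A :=
    Finset.sum_le_sum fun i _ => by
      have := norm_residualMap_gramSchmidtNormed_le f (A (EuclideanSpace.basisFun (Fin n) ℝ i))
      rw [LinearMap.comp_apply]
      gcongr
  have hadj : R.adjoint = R := (isSymmetric_residualMap _).adjoint_eq
  -- Taking adjoints moves the right-hand factor `R` to the left, where it is seen to be a
  -- contraction.
  have h1 : hsSq (sketchResidual T S) ≤ hsSq (R ∘ₗ T) := by
    rw [← hsSq_adjoint (sketchResidual T S), ← hsSq_adjoint (R ∘ₗ T), sketchResidual,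
      ← LinearMap.comp_assoc, LinearMap.adjoint_comp]
    change hsSq (R.adjoint ∘ₗ _) ≤ _
    rw [hadj]
    exact hle _
  have h2 : R ∘ₗ T = R ∘ₗ deflateSeq T S := LinearMap.ext hRT
  rw [h2] at h1
  exact h1.trans (hle _)

/-- Since `1 - Q Qᵀ` is idempotent, cyclicity of the trace shows that the residual's trace is `tr T
- tr (Qᵀ T Q)`. The first term of Hutch++ supplies exactly the missing part. -/
theorem hutchValue_sub_trace (T : Vec n →ₗ[ℝ] Vec n) (hq : q ≠ 0) (seed : HutchSeed n q) :
    hutchValue T seed - LinearMap.trace ℝ _ T = (1 / (q : ℝ)) *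
      ∑ j, (inner ℝ (signVec (seed.2 j)) (sketchResidual T seed.1 (signVec (seed.2 j))) -
        LinearMap.trace ℝ _ (sketchResidual T seed.1)) := by
  set Q : Fin q → Vec n := gramSchmidtNormed ℝ fun j => T (seed.1.vec j) with hQ
  have h1 : LinearMap.trace ℝ _ (sketchResidual T seed.1) =
      LinearMap.trace ℝ _ T - ∑ a, inner ℝ (Q a) (T (Q a)) := by
    rw [← trace_comp_residualMap]
    change LinearMap.trace ℝ _ (residualMap Q * (T ∘ₗ residualMap Q)) = _
    rw [LinearMap.trace_mul_comm]
    congr 1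
    ext1 x
    change T (residualMap Q (residualMap Q x)) = T (residualMap Q x)
    rw [residualMap_gramSchmidtNormed_idem]
  have h2 (x : Vec n) : inner ℝ x (sketchResidual T seed.1 x) =
      inner ℝ (residualMap Q x) (T (residualMap Q x)) :=
    (isSymmetric_residualMap Q x _).symm
  have h3 : hutchValue T seed = ∑ j, inner ℝ (Q j) (T (Q j)) + (1 / (q : ℝ)) *
      ∑ j, inner ℝ (residualMap Q (signVec (seed.2 j)))
        (T (residualMap Q (signVec (seed.2 j)))) := by
    simp only [residualMap_apply]
    rfl
  have hq' : (q : ℝ) ≠ 0 := Nat.cast_ne_zero.2 hq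
  simp only [h2, Finset.sum_sub_distrib, Finset.sum_const, Finset.card_univ, Fintype.card_fin,
    nsmul_eq_mul, h1, h3]
  field_simp
  ring

/-- The probability of an event under the uniform distribution. -/
noncomputable def unifProb {Ω : Type*} [Fintype Ω] (s : Set Ω) : ℝ :=
  𝔼 x, s.indicator 1 x

theorem expect_prod_eq_pow {Ω : Type*} [Fintype Ω] (F : Ω → ℝ) (q : ℕ) :
    𝔼 G : Fin q → Ω, ∏ j, F (G j) = (𝔼 x, F x) ^ q := by
  rw [Finset.expect_pow, Fintype.piFinset_univ]

theorem expect_exp_sum_le (B : Vec n →ₗ[ℝ] Vec n) (t : ℝ) (h : t ^ 2 * hsSq B ≤ 1 / 64) :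
    𝔼 G : SignSeed n q, Real.exp (t * ∑ j, (inner ℝ (signVec (G j)) (B (signVec (G j))) -
      LinearMap.trace ℝ _ B)) ≤ Real.exp (q * (2 * (t ^ 2 * hsSq B))) := by
  have h1 := expect_exp_inner_le (t • B) (by rwa [hsSq_smul])
  rw [hsSq_smul, map_smul, smul_eq_mul] at h1
  set F : (Fin n → Bool) → ℝ := fun x => Real.exp (t * (inner ℝ (signVec x) (B (signVec x)) -
      LinearMap.trace ℝ _ B)) with hF
  have h2 : 𝔼 x, F x ≤ Real.exp (2 * (t ^ 2 * hsSq B)) := by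
    have h3 (x) : F x = Real.exp (inner ℝ (signVec x) ((t • B) (signVec x))) *
        Real.exp (-(t * LinearMap.trace ℝ _ B)) := by
      rw [← Real.exp_add, hF, LinearMap.smul_apply, inner_smul_right]
      ring_nf
    simp only [h3, ← Finset.expect_mul]
    calc _ ≤ Real.exp (t * LinearMap.trace ℝ _ B + 2 * (t ^ 2 * hsSq B)) *
          Real.exp (-(t * LinearMap.trace ℝ _ B)) := by gcongr
      _ = _ := by rw [← Real.exp_add]; ring_nf
  have h4 : 𝔼 G : SignSeed n q, Real.exp (t * ∑ j, (inner ℝ (signVec (G j)) (B (signVec (G j))) -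
      LinearMap.trace ℝ _ B)) = (𝔼 x, F x) ^ q := by
    rw [← expect_prod_eq_pow]
    refine Finset.expect_congr rfl fun G _ => ?_
    rw [Finset.mul_sum, Real.exp_sum]
  rw [h4, Real.exp_nat_mul]
  exact pow_le_pow_left₀ (Finset.expect_nonneg fun x _ => Real.exp_nonneg _) h2 q

/-- Concentration of Hutchinson's trace estimator. -/
theorem unifProb_hutchinson_le (B : Vec n →ₗ[ℝ] Vec n) {β θ τ : ℝ} (hβ : 0 < β)
    (hB : hsSq B ≤ β ^ 2) (hθ0 : 0 ≤ θ) (hθ : θ ≤ 1) :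
    unifProb {G : SignSeed n q | τ < |∑ j, (inner ℝ (signVec (G j)) (B (signVec (G j))) -
      LinearMap.trace ℝ _ B)|} ≤ 2 * Real.exp (q * (θ ^ 2 / 32) - θ / (8 * β) * τ) := by
  -- Chernoff parameter: `t² * hsSq B ≤ θ² / 64`, so `θ ≤ 1` keeps it within the range of the moment
  -- bound.
  set t := θ / (8 * β) with ht
  have ht0 : 0 ≤ t := by positivity
  have h1 : t ^ 2 * hsSq B ≤ θ ^ 2 / 64 := by
    calc t ^ 2 * hsSq B ≤ t ^ 2 * β ^ 2 := by gcongr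
      _ = θ ^ 2 / 64 := by rw [ht]; field_simp; norm_num
  have hθ2 : θ ^ 2 ≤ 1 := pow_le_one₀ hθ0 hθ
  set Y : SignSeed n q → ℝ := fun G => ∑ j, (inner ℝ (signVec (G j)) (B (signVec (G j))) -
      LinearMap.trace ℝ _ B) with hY
  have h2 (u : ℝ) (hu : u ^ 2 = t ^ 2) :
      𝔼 G, Real.exp (u * Y G) ≤ Real.exp (q * (θ ^ 2 / 32)) := by
    refine (expect_exp_sum_le B u (by rw [hu]; linarith)).trans (Real.exp_le_exp.2 ?_)
    rw [hu]
    gcongr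
    linarith
  calc unifProb {G : SignSeed n q | τ < |Y G|} ≤
        𝔼 G, Real.exp (-(t * τ)) * (Real.exp (t * Y G) + Real.exp (-t * Y G)) := by
        refine Finset.expect_le_expect fun G _ => Set.indicator_apply_le' (fun hG => ?_)
          fun _ => by positivity
        rw [Set.mem_ofPred_eq] at hG
        have h3 : Real.exp (t * |Y G|) ≤ Real.exp (t * Y G) + Real.exp (-t * Y G) := by
          rcases abs_choice (Y G) with h | h <;> rw [h]
          · linarith [Real.exp_nonneg (-t * Y G)]
          · rw [mul_neg, neg_mul]
            linarith [Real.exp_nonneg (t * Y G)]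
        calc (1 : SignSeed n q → ℝ) G = 1 := rfl
          _ ≤ Real.exp (-(t * τ)) * Real.exp (t * |Y G|) := by
            rw [← Real.exp_add]
            refine Real.one_le_exp ?_
            have := mul_le_mul_of_nonneg_left hG.le ht0
            linarith
          _ ≤ _ := by gcongr
    _ ≤ Real.exp (-(t * τ)) * (Real.exp (q * (θ ^ 2 / 32)) + Real.exp (q * (θ ^ 2 / 32))) := by
        rw [← Finset.mul_expect, Finset.expect_add_distrib]
        gcongr
        · exact h2 _ rfl
        · exact h2 _ (by ring)
    _ = _ := by
        rw [← two_mul, mul_left_comm, ← Real.exp_add]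
        congr 2
        ring

theorem unifProb_prod_le {Ω Ω' : Type*} [Fintype Ω] [Fintype Ω'] (s : Set (Ω × Ω')) (F : Ω → ℝ)
    (h : ∀ x, unifProb {y | (x, y) ∈ s} ≤ F x) : unifProb s ≤ 𝔼 x, F x := by
  refine le_trans (le_of_eq ?_) (Finset.expect_le_expect fun x _ => h x)
  rw [unifProb, ← Finset.univ_product_univ, Finset.expect_product]
  rfl

theorem unifProb_le_one {Ω : Type*} [Fintype Ω] [Nonempty Ω] (s : Set Ω) : unifProb s ≤ 1 := by
  rw [unifProb, ← Fintype.expect_one (ι := Ω) (M := ℝ)]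
  exact Finset.expect_le_expect fun x _ => Set.indicator_le_self' (fun _ _ => zero_le_one) x

theorem unifProb_hutchValue_le {T : Vec n →ₗ[ℝ] Vec n} {N ε : ℝ} {l : ℝ} (hT : NuclearBound T N)
    (hN : 0 < N) (hε : 0 < ε) (hl : 0 < l) (hq : 1000 * (√l / ε + l) ≤ q) :
    unifProb {seed : HutchSeed n q |
      ε * N < |hutchValue T seed - LinearMap.trace ℝ _ T|} ≤ 3 * Real.exp (-(5 * l)) := by
  have hsl : 0 < √l := Real.sqrt_pos.2 hl
  have hq1 : 1000 * l ≤ q := by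
    have : 0 < √l / ε := by positivity
    linarith
  have hq2 : 1000 * √l ≤ q * ε := by
    have h1 : 1000 * (√l / ε) ≤ q := by linarith
    rw [← mul_div_assoc, div_le_iff₀ hε] at h1
    exact h1
  have hq0 : (0 : ℝ) < q := by linarith
  have hqN : q ≠ 0 := by
    rintro rfl
    simp at hq0
  -- Condition on the sketch `S`. The first summand is at least `1` on bad sketches (Markov), the
  -- second bounds Hutchinson's failure on good ones.
  refine (unifProb_prod_le _ (fun S => Real.exp (q / 40) *
    residualPotential N (hsSq (deflateSeq T S)) + 2 * Real.exp (-(5 * l))) fun S => ?_).trans ?_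
  · by_cases hS : hsSq (deflateSeq T S) ≤ 320 * N ^ 2 / q
    · refine le_trans ?_ (le_add_of_nonneg_left
        (mul_nonneg (Real.exp_nonneg _) (residualPotential_nonneg _ _)))
      set β := √(320 * N ^ 2 / q) with hβ
      have hβ0 : 0 < β := Real.sqrt_pos.2 (by positivity)
      have hβ2 : β ^ 2 = 320 * N ^ 2 / q := Real.sq_sqrt (by positivity)
      -- This makes the variance term `l / 32` while the deviation term is at least `6 l`, leaving
      -- `exp (-(5 * l))`.
      set θ := √(l / q) with hθ
      have hθ0 : 0 ≤ θ := Real.sqrt_nonneg _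
      have hθ2 : θ ^ 2 = l / q := Real.sq_sqrt (by positivity)
      have hθ1 : θ ≤ 1 := by
        rw [hθ, Real.sqrt_le_one]
        rw [div_le_one hq0]
        linarith
      have key := unifProb_hutchinson_le (q := q) (sketchResidual T S) (τ := q * (ε * N)) hβ0
        (((hsSq_sketchResidual_le T S).trans hS).trans_eq hβ2.symm) hθ0 hθ1
      have hset : {G : SignSeed n q | (S, G) ∈ {seed : HutchSeed n q |
          ε * N < |hutchValue T seed - LinearMap.trace ℝ _ T|}} =
          {G : SignSeed n q | q * (ε * N) < |∑ j, (inner ℝ (signVec (G j))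
            (sketchResidual T S (signVec (G j))) - LinearMap.trace ℝ _ (sketchResidual T S))|} := by
        ext G
        simp only [Set.mem_ofPred_eq, hutchValue_sub_trace T hqN, abs_mul]
        rw [abs_of_nonneg (by positivity), one_div, ← div_eq_inv_mul, lt_div_iff₀ hq0, mul_comm]
      rw [hset]
      refine key.trans ?_
      gcongr
      have h1 : q * (θ ^ 2 / 32) = l / 32 := by rw [hθ2]; field_simp
      have h2 : 6 * l ≤ θ / (8 * β) * (q * (ε * N)) := by
        rw [div_mul_eq_mul_div, le_div_iff₀ (by positivity)]
        refine le_of_sq_le_sq ?_ (by positivity)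
        have h3 : (1000 * √l) ^ 2 ≤ (q * ε) ^ 2 := by gcongr
        rw [mul_pow, Real.sq_sqrt hl.le] at h3
        calc (6 * l * (8 * β)) ^ 2 = 737280 * (l ^ 2 * (N ^ 2 / q)) := by
              rw [mul_pow, mul_pow _ β, hβ2]; ring
          _ ≤ 1000 ^ 2 * (l ^ 2 * (N ^ 2 / q)) := by gcongr; norm_num
          _ = (1000 ^ 2 * l) * (l / q * N ^ 2) := by ring
          _ ≤ (q * ε) ^ 2 * (l / q * N ^ 2) := by gcongr
          _ = (θ * (q * (ε * N))) ^ 2 := by rw [mul_pow θ, hθ2]; ring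
      rw [h1]
      linarith
    · push Not at hS
      refine (unifProb_le_one _).trans (le_add_of_le_of_nonneg ?_ (by positivity))
      have h0 : 0 < 320 * N ^ 2 / q := by positivity
      rw [residualPotential, if_neg (h0.trans hS).not_ge, ← Real.exp_add]
      refine Real.one_le_exp ?_
      have : 8 * N ^ 2 / hsSq (deflateSeq T S) ≤ q / 40 := by
        rw [div_le_iff₀ (h0.trans hS)]
        calc 8 * N ^ 2 = q / 40 * (320 * N ^ 2 / q) := by field_simp; norm_num
          _ ≤ _ := by gcongr
      linarith
  · rw [Finset.expect_add_distrib, Fintype.expect_const, ← Finset.mul_expect]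
    have h1 := expect_residualPotential_deflateSeq_le q hT
    have h2 : Real.exp (q / 40) * (𝔼 S : SignSeed n q,
        residualPotential N (hsSq (deflateSeq T S))) ≤ Real.exp (-(5 * l)) := by
      calc _ ≤ Real.exp (q / 40) * (Real.exp (-(q / 20)) * 1) := by
            refine mul_le_mul_of_nonneg_left (h1.trans ?_) (Real.exp_nonneg _)
            gcongr
            exact residualPotential_le_one _ _
        _ = Real.exp (-(q / 40)) := by
            rw [mul_one, ← Real.exp_add]
            congr 1
            ring
        _ ≤ _ := by
            gcongr
            linarith
    linarith

/-- The accuracy of Hutch++. -/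
theorem unifProb_hutchValue_hutchSize_le {T : Vec n →ₗ[ℝ] Vec n} {N ε δ : ℝ}
    (hT : NuclearBound T N) (hN : 0 < N) (hε : 0 < ε) (hδ : 0 < δ) (hδ2 : δ ≤ 1 / 2) :
    unifProb {seed : HutchSeed n (hutchSize 1000 ε δ) |
      ε * N < |hutchValue T seed - LinearMap.trace ℝ _ T|} ≤ δ / 4 := by
  have hl : 0 < Real.log (1 / δ) := Real.log_pos (by rw [lt_div_iff₀ hδ]; linarith)
  refine (unifProb_hutchValue_le hT hN hε hl (Nat.le_ceil _)).trans ?_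
  have h : Real.exp (-(5 * Real.log (1 / δ))) = δ ^ 5 := by
    rw [one_div, Real.log_inv, mul_neg, neg_neg, mul_comm, Real.exp_mul, Real.exp_log hδ]
    norm_cast
  rw [h]
  -- This gives `3 δ⁵ ≤ 3 δ / 16 ≤ δ / 4`; the gain of `1 / 4` pays for the union bound over the
  -- tree.
  have h4 : δ ^ 4 ≤ (1 / 2) ^ 4 := by gcongr
  nlinarith

end HutchPP

/-! ### Outputs and query counts of composed algorithms. -/

namespace MatVecAlg

variable {n : ℕ} {ι β γ : Type} (A : ι → Matrix (Fin n) (Fin n) ℝ)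

theorem output_bind (a : MatVecAlg n ι β) (f : β → MatVecAlg n ι γ) :
    (a.bind f).output A = (f (a.output A)).output A := by
  induction a with
  | done b => rfl
  | query i x next ih => exact ih _

theorem queryCount_bind (a : MatVecAlg n ι β) (f : β → MatVecAlg n ι γ) :
    (a.bind f).queryCount A = a.queryCount A + (f (a.output A)).queryCount A := by
  induction a with
  | done b => simp [bind, queryCount, output]
  | query i x next ih =>
    simp only [bind, queryCount, output, ih]
    omega

theorem output_forEach {q : ℕ} {β : Fin q → Type} (f : ∀ j, MatVecAlg n ι (β j)) (j : Fin q) :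
    (forEach f).output A j = (f j).output A := by
  induction q with
  | zero => exact j.elim0
  | succ q ih =>
    simp only [forEach, output_bind, output]
    refine Fin.cases ?_ (fun j => ?_) j
    · rfl
    · exact ih (fun j => f j.succ) j

theorem queryCount_forEach {q : ℕ} {β : Fin q → Type} (f : ∀ j, MatVecAlg n ι (β j)) :
    (forEach f).queryCount A = ∑ j, (f j).queryCount A := by
  induction q with
  | zero => rfl
  | succ q ih =>
    rw [Fin.sum_univ_succ]
    simp only [forEach, queryCount_bind, queryCount, ih, add_zero]

end MatVecAlg

open MatVecAlg

/-! ### Outputs, locality and query count of the tree algorithm. -/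

section Algorithm

variable {n : ℕ} {ι : Type} (A : ι → Matrix (Fin n) (Fin n) ℝ)

theorem queryCount_hutchPP {q : ℕ} {mv : Vec n → MatVecAlg n ι (Vec n)} {k : ℕ}
    (hmv : ∀ x, (mv x).queryCount A = k) (seed : HutchSeed n q) :
    (hutchPP mv seed).queryCount A = 3 * q * k := by
  simp only [hutchPP, queryCount_bind, queryCount_forEach, hmv, queryCount, Finset.sum_const,
    Finset.card_univ, Fintype.card_fin, smul_eq_mul]
  ring

theorem output_hutchPP {q : ℕ} {mv : Vec n → MatVecAlg n ι (Vec n)} {T : Vec n →ₗ[ℝ] Vec n}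
    (hmv : ∀ x, (mv x).output A = T x) (seed : HutchSeed n q) :
    (hutchPP mv seed).output A = hutchValue T seed := by
  have h {q : ℕ} (f : Fin q → Vec n) : (forEach fun j => mv (f j)).output A = fun j => T (f j) := by
    funext j
    rw [output_forEach, hmv]
  simp only [hutchPP, output_bind, output, h]
  rfl

theorem output_mulVec (i : ι) (x : Vec n) :
    (mulVec i x).output A = Matrix.toEuclideanLin (A i) x := rfl

theorem output_subMulVec (i j : ι) (x : Vec n) :
    (subMulVec i j x).output A = Matrix.toEuclideanLin (A i - A j) x := by
  rw [map_sub]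
  rfl

/-- Only nodes whose right end is at most `j` are read. This is why the estimates never look ahead.
-/
theorem sumTree_congr {t t' : ℕ → ℕ → ℝ} (l p j : ℕ) (hp : 2 ^ l ∣ p)
    (h : ∀ k r, r < l → (k + 1) * 2 ^ r ≤ j → t (k + 1) r = t' (k + 1) r) :
    sumTree t l p j = sumTree t' l p j := by
  induction l generalizing p with
  | zero => rfl
  | succ l ih =>
    have hp' : 2 ^ l ∣ p := (pow_dvd_pow 2 l.le_succ).trans hp
    have h' := fun k r (hr : r < l) => h k r (hr.trans l.lt_succ_self)
    simp only [sumTree]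
    split_ifs with hj
    · rw [ih _ ((Nat.dvd_add_right hp').2 dvd_rfl) h', h _ _ l.lt_succ_self]
      rwa [add_mul, Nat.div_mul_cancel hp', one_mul]
    · exact ih _ hp' h'

/-- The increments of `a` over the chosen dyadic intervals telescope, and each level contributes at
most one error `η`. -/
theorem abs_sumTree_sub_le {t : ℕ → ℕ → ℝ} {a : ℕ → ℝ} {η : ℝ} (l p j : ℕ) (hp : 2 ^ l ∣ p)
    (hpj : p ≤ j) (hj : j < p + 2 ^ l)
    (h : ∀ k r, r < l → (k + 1) * 2 ^ r ≤ j →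
      |t (k + 1) r - (a ((k + 1) * 2 ^ r) - a (k * 2 ^ r))| ≤ η) (hη : 0 ≤ η) :
    |sumTree t l p j - (a j - a p)| ≤ l * η := by
  induction l generalizing p with
  | zero =>
    obtain rfl : j = p := by simp at hj; omega
    simp [sumTree]
  | succ l ih =>
    have hp' : 2 ^ l ∣ p := (pow_dvd_pow 2 l.le_succ).trans hp
    have h' := fun k r (hr : r < l) => h k r (hr.trans l.lt_succ_self)
    rw [pow_succ] at hj
    push_cast
    simp only [sumTree]
    split_ifs with hjl
    · have h1 := ih (p + 2 ^ l) ((Nat.dvd_add_right hp').2 dvd_rfl) hjl (by omega) h'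
      have h2 := h (p / 2 ^ l) l l.lt_succ_self
      rw [add_mul, Nat.div_mul_cancel hp', one_mul] at h2
      have h3 := abs_add_le (t (p / 2 ^ l + 1) l - (a (p + 2 ^ l) - a p))
        (sumTree t l (p + 2 ^ l) j - (a j - a (p + 2 ^ l)))
      have h4 := h2 hjl
      calc _ = |t (p / 2 ^ l + 1) l - (a (p + 2 ^ l) - a p) +
            (sumTree t l (p + 2 ^ l) j - (a j - a (p + 2 ^ l)))| := by congr 1; ring
        _ ≤ _ := by linarith
    · exact (ih p hp' hpj (by omega) h').trans (by linarith)

/-- The table of node values, from which the tree algorithm computes its output. -/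
noncomputable def nodeTable {c : ℝ} {n m : ℕ} (hm : 0 < m) {α ε δ : ℝ}
    (A : Fin m → Matrix (Fin n) (Fin n) ℝ) (ω : TreeSeed c n m α ε δ) (k l : ℕ) : ℝ :=
  if hl : l < numLevels m then
    -- The subtraction is truncated, so `k = 0` can repeat the entry of node `1`; `sumTree` only
    -- reads positive `k`.
    if hk : k - 1 < (m - 1) / 2 ^ l then
      hutchValue (Matrix.toEuclideanLin
        (A ⟨(k - 1 + 1) * 2 ^ l, treeNode_lt hm l ⟨k - 1, hk⟩⟩ -
          A ⟨(k - 1) * 2 ^ l, treeNode_pred_lt hm l ⟨k - 1, hk⟩⟩)) (ω.2 ⟨l, hl⟩ ⟨k - 1, hk⟩)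
    else 0
  else 0

theorem nodeTable_succ {c : ℝ} {n m : ℕ} (hm : 0 < m) {α ε δ : ℝ}
    (A : Fin m → Matrix (Fin n) (Fin n) ℝ) (ω : TreeSeed c n m α ε δ)
    (l : Fin (numLevels m)) (k : Fin ((m - 1) / 2 ^ (l : ℕ))) :
    nodeTable hm A ω (k + 1) l = hutchValue (Matrix.toEuclideanLin
        (A ⟨(k + 1) * 2 ^ (l : ℕ), treeNode_lt hm l k⟩ -
          A ⟨k * 2 ^ (l : ℕ), treeNode_pred_lt hm l k⟩)) (ω.2 l k) := by
  rw [nodeTable, dif_pos l.isLt, dif_pos (by simp)]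
  rfl

theorem output_treeAlgorithm {c : ℝ} {n m : ℕ} (hm : 0 < m) {α ε δ : ℝ}
    (A : Fin m → Matrix (Fin n) (Fin n) ℝ) (ω : TreeSeed c n m α ε δ) (i : Fin m) :
    (treeAlgorithm c n m hm α ε δ ω).output A i =
      hutchValue (Matrix.toEuclideanLin (A ⟨0, hm⟩)) ω.1 +
        sumTree (nodeTable hm A ω) (numLevels m) 0 i := by
  simp only [treeAlgorithm, output_bind, output, output_forEach]
  rw [output_hutchPP A (output_mulVec A _)]
  congr 2
  funext k l
  unfold nodeTable
  split_ifs
  · rw [output_hutchPP A (output_subMulVec A _ _)]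
  · rfl
  · rfl

theorem output_treeAlgorithm_congr {c : ℝ} {n m : ℕ} (hm : 0 < m) {α ε δ : ℝ}
    (A A' : Fin m → Matrix (Fin n) (Fin n) ℝ) (ω : TreeSeed c n m α ε δ) (i : Fin m)
    (h : ∀ j ≤ i, A j = A' j) :
    (treeAlgorithm c n m hm α ε δ ω).output A i =
      (treeAlgorithm c n m hm α ε δ ω).output A' i := by
  rw [output_treeAlgorithm, output_treeAlgorithm, h ⟨0, hm⟩ (Nat.zero_le _)]
  congr 1
  refine sumTree_congr _ _ _ (dvd_zero _) fun k r hr hk => ?_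
  have hk' : k < (m - 1) / 2 ^ r := by
    rw [← Nat.succ_le_iff, Nat.le_div_iff_mul_le (by positivity)]
    have := i.isLt
    exact hk.trans (by omega)
  have h1 := nodeTable_succ hm A ω ⟨r, hr⟩ ⟨k, hk'⟩
  have h2 := nodeTable_succ hm A' ω ⟨r, hr⟩ ⟨k, hk'⟩
  simp only at h1 h2
  rw [h1, h2, h _ (Fin.mk_le_of_le_val hk), h _ (Fin.mk_le_of_le_val
    ((Nat.mul_le_mul_right _ k.le_succ).trans hk))]

/-- Hutch++ with `q` columns makes `3 q` products, and a product with a difference costs two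
queries, hence the factor `6` at the nodes. -/
theorem queryCount_treeAlgorithm {c : ℝ} {n m : ℕ} (hm : 0 < m) {α ε δ : ℝ}
    (A : Fin m → Matrix (Fin n) (Fin n) ℝ) (ω : TreeSeed c n m α ε δ) :
    (treeAlgorithm c n m hm α ε δ ω).queryCount A = 3 * hutchSize c (ε / 2) (δ / 2) +
      ∑ l : Fin (numLevels m), (m - 1) / 2 ^ (l : ℕ) * (6 * levelSize c m α ε δ l) := by
  simp only [treeAlgorithm, queryCount_bind, queryCount_forEach, queryCount]
  rw [queryCount_hutchPP A (k := 1) (fun _ => rfl)]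
  simp only [queryCount_hutchPP A (k := 2) (mv := subMulVec _ _) (fun _ => rfl), Finset.sum_const,
    Finset.card_univ, Fintype.card_fin, smul_eq_mul]
  rw [mul_one, add_zero]
  congr 1
  exact Finset.sum_congr rfl fun l _ => by ring

end Algorithm

/-! ### Uniform probability: union bound and marginals. -/

section UniformProbability

variable {Ω Ω' ι : Type*} [Fintype Ω] [Fintype Ω'] [Fintype ι]

theorem unifProb_mono {s t : Set Ω} (h : s ⊆ t) : unifProb s ≤ unifProb t :=
  Finset.expect_le_expect fun _ _ =>
    Set.indicator_le_indicator_of_subset h (fun _ => zero_le_one) _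

theorem unifProb_union_le (s t : Set Ω) : unifProb (s ∪ t) ≤ unifProb s + unifProb t := by
  rw [unifProb, unifProb, unifProb, ← Finset.expect_add_distrib]
  refine Finset.expect_le_expect fun x _ => ?_
  by_cases hs : x ∈ s <;> by_cases ht : x ∈ t <;> simp [hs, ht]

theorem unifProb_iUnion_le (s : ι → Set Ω) : unifProb (⋃ i, s i) ≤ ∑ i, unifProb (s i) := by
  simp only [unifProb]
  rw [← Finset.expect_sum_comm]
  refine Finset.expect_le_expect fun x _ => Set.indicator_apply_le' (fun hx => ?_)
    fun _ => Finset.sum_nonneg fun i _ => Set.indicator_nonneg (fun _ _ => zero_le_one) x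
  obtain ⟨i, hi⟩ := Set.mem_iUnion.1 hx
  refine le_trans ?_ (Finset.single_le_sum (f := fun i => (s i).indicator (1 : Ω → ℝ) x)
    (fun i _ => Set.indicator_nonneg (fun _ _ => zero_le_one) x) (Finset.mem_univ i))
  simp [hi]

theorem one_sub_unifProb_compl [Nonempty Ω] (s : Set Ω) : 1 - unifProb sᶜ = unifProb s := by
  rw [unifProb, unifProb, ← Fintype.expect_one (ι := Ω) (M := ℝ), ← Finset.expect_sub_distrib]
  refine Finset.expect_congr rfl fun x _ => ?_
  by_cases hs : x ∈ s <;> simp [hs]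

theorem unifProb_fst [Nonempty Ω'] (s : Set Ω) :
    unifProb {p : Ω × Ω' | p.1 ∈ s} = unifProb s := by
  rw [unifProb, ← Finset.univ_product_univ, Finset.expect_product]
  exact Finset.expect_congr rfl fun x _ => Fintype.expect_const (s.indicator 1 x)

theorem unifProb_snd [Nonempty Ω] (s : Set Ω') :
    unifProb {p : Ω × Ω' | p.2 ∈ s} = unifProb s := by
  rw [unifProb, ← Finset.univ_product_univ, Finset.expect_product]
  exact Fintype.expect_const (unifProb s)

theorem unifProb_equiv (e : Ω ≃ Ω') (s : Set Ω') : unifProb {x | e x ∈ s} = unifProb s :=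
  Fintype.expect_equiv e _ _ fun _ => rfl

theorem unifProb_eval [DecidableEq ι] {β : ι → Type*} [∀ i, Fintype (β i)] [∀ i, Nonempty (β i)]
    (i : ι) (s : Set (β i)) : unifProb {x : ∀ i, β i | x i ∈ s} = unifProb s := by
  rw [← unifProb_fst (Ω' := ∀ j : {j // j ≠ i}, β j) s, ← unifProb_equiv (Equiv.piSplitAt i β)]
  rfl

theorem unifProb_node [Nonempty Ω] [DecidableEq ι] {κ β : ι → Type*} [∀ i, Fintype (κ i)]
    [∀ i, DecidableEq (κ i)] [∀ i, Fintype (β i)] [∀ i, Nonempty (β i)] (i : ι) (k : κ i)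
    (s : Set (β i)) : unifProb {ω : Ω × ∀ i, κ i → β i | ω.2 i k ∈ s} = unifProb s := by
  rw [← unifProb_eval (β := fun _ => β i) k s,
    ← unifProb_eval (β := fun i => κ i → β i) i {x | x k ∈ s},
    ← unifProb_snd (Ω := Ω) {x : ∀ i, κ i → β i | x i ∈ {x | x k ∈ s}}]
  rfl

theorem uniformOn_real_eq_unifProb [MeasurableSpace Ω] [MeasurableSingletonClass Ω] (s : Set Ω) :
    (ProbabilityTheory.uniformOn (Set.univ : Set Ω)).real s = unifProb s := by
  classical
  rw [MeasureTheory.measureReal_def, ProbabilityTheory.uniformOn_univ, unifProb,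
    Fintype.expect_eq_sum_div_card, MeasureTheory.Measure.count_apply s.toFinite.measurableSet,
    ENNReal.toReal_div, ENNReal.toReal_natCast]
  congr 1
  rw [Set.encard_eq_coe_toFinset_card, Finset.sum_indicator_eq_sum_filter]
  simp

end UniformProbability

/-! ### Number of nodes and of levels of the tree. -/

theorem sum_natDiv_two_pow_le (m L : ℕ) :
    ∑ l : Fin L, (((m - 1) / 2 ^ (l : ℕ) : ℕ) : ℝ) ≤ 2 * m := by
  calc ∑ l : Fin L, (((m - 1) / 2 ^ (l : ℕ) : ℕ) : ℝ) ≤ ∑ l : Fin L, m * (1 / 2 : ℝ) ^ (l : ℕ) := by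
        refine Finset.sum_le_sum fun l _ => Nat.cast_div_le.trans ?_
        rw [one_div, inv_pow, ← div_eq_mul_inv]
        push_cast
        gcongr
        omega
    _ = m * ∑ l ∈ Finset.range L, (1 / 2 : ℝ) ^ l := by
        rw [← Finset.mul_sum, Finset.sum_range]
    _ ≤ m * 2 := by
        gcongr
        exact sum_geometric_two_le L
    _ = 2 * m := mul_comm _ _

theorem numLevels_pos {m : ℕ} (hm : 2 ≤ m) : 0 < numLevels m :=
  Nat.clog_pos one_lt_two hm

theorem numLevels_le {m : ℕ} (hm : 2 ≤ m) : (numLevels m : ℝ) ≤ 3 * Real.log m := by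
  have h1 : 2 ^ (numLevels m).pred < m := Nat.pow_pred_clog_lt_self one_lt_two hm
  have h2 : ((numLevels m).pred : ℝ) * Real.log 2 ≤ Real.log m := by
    rw [← Real.log_pow]
    exact Real.log_le_log (by positivity) (by exact_mod_cast h1.le)
  have h3 : Real.log 2 ≤ Real.log m := Real.log_le_log two_pos (by exact_mod_cast hm)
  have h4 : (numLevels m : ℝ) = (numLevels m).pred + 1 := by
    exact_mod_cast (Nat.succ_pred_eq_of_pos (numLevels_pos hm)).symm
  have h5 := Real.log_two_gt_d9
  have h6 : (numLevels m : ℝ) * Real.log 2 ≤ 2 * Real.log m := by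
    rw [h4]; linarith
  have h7 : (0 : ℝ) ≤ numLevels m := Nat.cast_nonneg _
  nlinarith

theorem pos_of_two_le {m : ℕ} (hm : 2 ≤ m) : 0 < m := two_pos.trans_le hm

/-! ### Accuracy of all estimates simultaneously. -/

section Accuracy

variable {n : ℕ}

theorem trace_toEuclideanLin (A : Matrix (Fin n) (Fin n) ℝ) :
    LinearMap.trace ℝ _ (Matrix.toEuclideanLin A) = A.trace := by
  rw [Matrix.toEuclideanLin_eq_toLin_orthonormal]
  exact Matrix.trace_toLin_eq _ _

/-- Telescoping over consecutive differences; the dual form makes the triangle inequality immediate.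
-/
theorem nuclearBound_sub {m : ℕ} {α : ℝ} (A : Fin m → Matrix (Fin n) (Fin n) ℝ)
    (hA : ∀ (i : ℕ) (hi : i + 1 < m),
      nuclearNorm (A ⟨i + 1, hi⟩ - A ⟨i, Nat.lt_of_succ_lt hi⟩) ≤ α) (i k : ℕ) (hik : i + k < m) :
    NuclearBound (Matrix.toEuclideanLin (A ⟨i + k, hik⟩ - A ⟨i, by omega⟩)) (k * α) := by
  induction k with
  | zero => simpa using NuclearBound.zero
  | succ k ih =>
    have h1 := ((nuclearBound_nuclearNorm _).mono (hA (i + k) (by omega))).add (ih (by omega))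
    rw [← map_add, sub_add_sub_cancel] at h1
    exact h1.mono (le_of_eq (by push_cast; ring))

theorem abs_output_treeAlgorithm_sub_trace_le {c : ℝ} {m : ℕ} (hm : 2 ≤ m) {α ε δ : ℝ}
    (hα : 0 < α) (hε : 0 < ε)
    (A : Fin m → Matrix (Fin n) (Fin n) ℝ) (ω : TreeSeed c n m α ε δ)
    (h0 : |hutchValue (Matrix.toEuclideanLin (A ⟨0, pos_of_two_le hm⟩)) ω.1 -
      (A ⟨0, pos_of_two_le hm⟩).trace| ≤ ε / 2)
    (h : ∀ (l : Fin (numLevels m)) (k : Fin ((m - 1) / 2 ^ (l : ℕ))),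
      |hutchValue (Matrix.toEuclideanLin
        (A ⟨(k + 1) * 2 ^ (l : ℕ), treeNode_lt (pos_of_two_le hm) l k⟩ -
          A ⟨k * 2 ^ (l : ℕ), treeNode_pred_lt (pos_of_two_le hm) l k⟩)) (ω.2 l k) -
        (A ⟨(k + 1) * 2 ^ (l : ℕ), treeNode_lt (pos_of_two_le hm) l k⟩ -
          A ⟨k * 2 ^ (l : ℕ), treeNode_pred_lt (pos_of_two_le hm) l k⟩).trace| ≤
        levelEps m α ε l * (2 ^ (l : ℕ) * α)) (i : Fin m) :
    |(treeAlgorithm c n m (pos_of_two_le hm) α ε δ ω).output A i - (A i).trace| ≤ ε := by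
  rw [output_treeAlgorithm]
  have hL : (0 : ℝ) < numLevels m := Nat.cast_pos.2 (numLevels_pos hm)
  set a : ℕ → ℝ := fun j => if hj : j < m then (A ⟨j, hj⟩).trace else 0 with ha
  have hlt : (i : ℕ) < 0 + 2 ^ numLevels m := by
    rw [zero_add]
    exact i.isLt.trans_le (Nat.le_pow_clog one_lt_two m)
  -- `levelEps m α ε r * (2 ^ r * α)` equals `ε / (2 * numLevels m)` on every level `r`.
  have key := abs_sumTree_sub_le (t := nodeTable (pos_of_two_le hm) A ω) (a := a)
    (η := ε / (2 * numLevels m)) (numLevels m) 0 i (dvd_zero _) (Nat.zero_le _) hlt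
    (fun k r hr hk => ?_) (by positivity)
  · have ha0 : a 0 = (A ⟨0, pos_of_two_le hm⟩).trace := dif_pos (by omega)
    have hai : a i = (A i).trace := dif_pos i.isLt
    rw [ha0, hai] at key
    have h2 : (numLevels m : ℝ) * (ε / (2 * numLevels m)) = ε / 2 := by field_simp
    rw [h2] at key
    have h3 := abs_add_le (hutchValue (Matrix.toEuclideanLin (A ⟨0, pos_of_two_le hm⟩)) ω.1 -
      (A ⟨0, pos_of_two_le hm⟩).trace) (sumTree (nodeTable (pos_of_two_le hm) A ω) (numLevels m) 0 i -
        ((A i).trace - (A ⟨0, pos_of_two_le hm⟩).trace))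
    refine le_trans (le_of_eq ?_) (h3.trans (by linarith))
    congr 1
    ring
  · have hk' : k < (m - 1) / 2 ^ r := by
      rw [← Nat.succ_le_iff, Nat.le_div_iff_mul_le (by positivity)]
      have := i.isLt
      exact hk.trans (by omega)
    have hn := nodeTable_succ (pos_of_two_le hm) A ω ⟨r, hr⟩ ⟨k, hk'⟩
    have h1 := h ⟨r, hr⟩ ⟨k, hk'⟩
    have hlt1 : (k + 1) * 2 ^ r < m := hk.trans_lt i.isLt
    have hlt2 : k * 2 ^ r < m := (Nat.mul_le_mul_right _ k.le_succ).trans_lt hlt1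
    have ha1 : a ((k + 1) * 2 ^ r) = (A ⟨_, hlt1⟩).trace := dif_pos hlt1
    have ha2 : a (k * 2 ^ r) = (A ⟨_, hlt2⟩).trace := dif_pos hlt2
    simp only at hn h1
    rw [hn, ha1, ha2, ← Matrix.trace_sub]
    refine h1.trans (le_of_eq ?_)
    rw [levelEps, pow_succ]
    field_simp

theorem one_sub_le_unifProb_treeAlgorithm {m : ℕ} (hm : 2 ≤ m) {α ε δ : ℝ} (hα : 0 < α)
    (hε : 0 < ε) (hδ : 0 < δ) (hδ1 : δ < 1) (A : Fin m → Matrix (Fin n) (Fin n) ℝ)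
    (hA0 : nuclearNorm (A ⟨0, pos_of_two_le hm⟩) ≤ 1)
    (hA : ∀ (i : ℕ) (hi : i + 1 < m),
      nuclearNorm (A ⟨i + 1, hi⟩ - A ⟨i, Nat.lt_of_succ_lt hi⟩) ≤ α) :
    1 - δ ≤ unifProb {ω : TreeSeed 1000 n m α ε δ | ∀ i : Fin m,
      |(treeAlgorithm 1000 n m (pos_of_two_le hm) α ε δ ω).output A i - (A i).trace| ≤ ε} := by
  have hm0 : 0 < m := pos_of_two_le hm
  have hm2 : (2 : ℝ) ≤ m := by exact_mod_cast hm
  have hL : (0 : ℝ) < numLevels m := Nat.cast_pos.2 (numLevels_pos hm)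
  set D : ∀ (l : Fin (numLevels m)), Fin ((m - 1) / 2 ^ (l : ℕ)) → Matrix (Fin n) (Fin n) ℝ :=
    fun l k => A ⟨(k + 1) * 2 ^ (l : ℕ), treeNode_lt hm0 l k⟩ -
      A ⟨k * 2 ^ (l : ℕ), treeNode_pred_lt hm0 l k⟩ with hD
  set E₀ : Set (HutchSeed n (hutchSize 1000 (ε / 2) (δ / 2))) :=
    {s | ε / 2 * 1 < |hutchValue (Matrix.toEuclideanLin (A ⟨0, hm0⟩)) s -
      LinearMap.trace ℝ _ (Matrix.toEuclideanLin (A ⟨0, hm0⟩))|} with hE₀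
  set E : ∀ (l : Fin (numLevels m)), Fin ((m - 1) / 2 ^ (l : ℕ)) →
      Set (HutchSeed n (levelSize 1000 m α ε δ l)) := fun l k =>
    {s | levelEps m α ε l * (2 ^ (l : ℕ) * α) < |hutchValue (Matrix.toEuclideanLin (D l k)) s -
      LinearMap.trace ℝ _ (Matrix.toEuclideanLin (D l k))|} with hE
  have hE₀le : unifProb E₀ ≤ δ / 2 / 4 :=
    unifProb_hutchValue_hutchSize_le ((nuclearBound_nuclearNorm _).mono hA0) one_pos
      (by positivity) (by positivity) (by linarith)
  have hEle (l : Fin (numLevels m)) (k : Fin ((m - 1) / 2 ^ (l : ℕ))) :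
      unifProb (E l k) ≤ δ / m / 4 := by
    have hnb := nuclearBound_sub A hA (k * 2 ^ (l : ℕ)) (2 ^ (l : ℕ)) (by
      have := treeNode_lt hm0 l k
      rwa [add_mul, one_mul] at this)
    refine unifProb_hutchValue_hutchSize_le ?_ (by positivity) ?_ (by positivity) ?_
    · simp only [hD, add_mul, one_mul]
      exact_mod_cast hnb
    · unfold levelEps
      positivity
    · rw [div_le_iff₀ (by linarith)]
      linarith
  rw [← one_sub_unifProb_compl]
  have hsub : {ω : TreeSeed 1000 n m α ε δ | ∀ i : Fin m,
      |(treeAlgorithm 1000 n m (pos_of_two_le hm) α ε δ ω).output A i - (A i).trace| ≤ ε}ᶜ ⊆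
      {ω | ω.1 ∈ E₀} ∪ ⋃ l, ⋃ k, {ω | ω.2 l k ∈ E l k} := by
    intro ω hω
    by_contra hcon
    simp only [Set.mem_union, Set.mem_iUnion, Set.mem_ofPred_eq, not_or, not_exists, hE₀, hE,
      not_lt, trace_toEuclideanLin, mul_one] at hcon
    exact hω (abs_output_treeAlgorithm_sub_trace_le hm hα hε A ω hcon.1 hcon.2)
  have h1 := (unifProb_mono hsub).trans (unifProb_union_le _ _)
  have h2 : unifProb {ω : TreeSeed 1000 n m α ε δ | ω.1 ∈ E₀} = unifProb E₀ := unifProb_fst _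
  have h3 (l k) : unifProb {ω : TreeSeed 1000 n m α ε δ | ω.2 l k ∈ E l k} = unifProb (E l k) :=
    unifProb_node (Ω := HutchSeed n (hutchSize 1000 (ε / 2) (δ / 2)))
      (κ := fun l : Fin (numLevels m) => Fin ((m - 1) / 2 ^ (l : ℕ)))
      (β := fun l : Fin (numLevels m) => HutchSeed n (levelSize 1000 m α ε δ l)) l k (E l k)
  -- At most `2 m` nodes fail with probability at most `δ / (4 m)` each; `E₀` adds only `δ / 8`.
  have h4 : unifProb (⋃ l, ⋃ k, {ω : TreeSeed 1000 n m α ε δ | ω.2 l k ∈ E l k}) ≤ δ / 2 := by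
    calc _ ≤ ∑ l : Fin (numLevels m), ∑ k : Fin ((m - 1) / 2 ^ (l : ℕ)), δ / m / 4 := by
          refine (unifProb_iUnion_le _).trans (Finset.sum_le_sum fun l _ =>
            (unifProb_iUnion_le _).trans (Finset.sum_le_sum fun k _ => ?_))
          rw [h3]
          exact hEle l k
      _ = (∑ l : Fin (numLevels m), (((m - 1) / 2 ^ (l : ℕ) : ℕ) : ℝ)) * (δ / m / 4) := by
          simp [Finset.sum_mul]
      _ ≤ 2 * m * (δ / m / 4) := by
          gcongr
          exact sum_natDiv_two_pow_le m _
      _ = δ / 2 := by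
          field_simp
          norm_num
  rw [h2] at h1
  linarith

end Accuracy

/-! ### The query bound and the main theorem. -/

theorem hutchSize_le {c ε δ l : ℝ} (hc : 0 ≤ c) (hε : 0 < ε) (hl0 : 0 ≤ Real.log (1 / δ))
    (hl : Real.log (1 / δ) ≤ l) : (hutchSize c ε δ : ℝ) ≤ c * (√l / ε + l) + 1 := by
  refine (Nat.ceil_lt_add_one (by positivity)).le.trans ?_
  gcongr

theorem queryCount_treeAlgorithm_le {n m : ℕ} (hm : 2 ≤ m) {α ε δ : ℝ} (hα : 0 < α)
    (hε : 0 < ε) (hδ : 0 < δ) (hδ1 : δ < 1) (A : Fin m → Matrix (Fin n) (Fin n) ℝ)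
    (ω : TreeSeed 1000 n m α ε δ) :
    (((treeAlgorithm 1000 n m (pos_of_two_le hm) α ε δ ω).queryCount A : ℕ) : ℝ) ≤
      200000 * ((m * α * Real.log m ^ 2 + 1) * (√(Real.log (m / δ)) / ε) +
        m * Real.log (m / δ)) := by
  rw [queryCount_treeAlgorithm]
  have hm2 : (2 : ℝ) ≤ m := by exact_mod_cast hm
  have hL : (0 : ℝ) < numLevels m := Nat.cast_pos.2 (numLevels_pos hm)
  set l := Real.log (m / δ) with hl
  set s := √l / ε with hs
  set L := numLevels m with hLdef
  -- Lets `m * l` absorb the additive constants caused by rounding up the sizes.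
  have hl2 : 1 / 2 ≤ l := by
    have h1 : Real.log 2 ≤ l := by
      refine Real.log_le_log two_pos ?_
      rw [le_div_iff₀ hδ]
      linarith
    linarith [Real.log_two_gt_d9]
  have hs0 : 0 ≤ s := by positivity
  have h0 : (hutchSize 1000 (ε / 2) (δ / 2) : ℝ) ≤ 1000 * (2 * s + l) + 1 := by
    refine (hutchSize_le (l := l) (by norm_num) (by positivity) ?_ ?_).trans_eq ?_
    · exact Real.log_nonneg (by rw [le_div_iff₀ (by positivity)]; linarith)
    · refine Real.log_le_log (by positivity) ?_
      rw [one_div_div]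
      gcongr
    · rw [hs]
      field_simp
  -- The factor `2 ^ r` in the size cancels against the number of nodes on level `r`, so the first
  -- term does not depend on `r`.
  have hnode (r : Fin L) : (((m - 1) / 2 ^ (r : ℕ) * (6 * levelSize 1000 m α ε δ r) : ℕ) : ℝ) ≤
      12000 * (m * α * L * s) +
        (((m - 1) / 2 ^ (r : ℕ) : ℕ) : ℝ) * (6 * (1000 * l + 1)) := by
    have h1 : (levelSize 1000 m α ε δ r : ℝ) ≤ 1000 * (s * (2 ^ ((r : ℕ) + 1) * α * L) + l) + 1 := by
      refine (hutchSize_le (l := l) (by norm_num) (by unfold levelEps; positivity) ?_ ?_).trans_eq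
        ?_
      · exact Real.log_nonneg (by
          rw [one_div_div, le_div_iff₀ (by positivity)]; linarith)
      · rw [one_div_div]
      · rw [hs, levelEps, ← hLdef]
        field_simp
    have h2 : (((m - 1) / 2 ^ (r : ℕ) : ℕ) : ℝ) * 2 ^ (r : ℕ) ≤ m := by
      exact_mod_cast (Nat.div_mul_le_self (m - 1) (2 ^ (r : ℕ))).trans (Nat.sub_le _ _)
    push_cast only [Nat.cast_mul]
    set d := (((m - 1) / 2 ^ (r : ℕ) : ℕ) : ℝ) with hd
    have hd0 : 0 ≤ d := Nat.cast_nonneg _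
    calc d * (6 * (levelSize 1000 m α ε δ r : ℝ)) ≤
          d * (6 * (1000 * (s * (2 ^ ((r : ℕ) + 1) * α * L) + l) + 1)) := by gcongr
      _ = 12000 * (d * 2 ^ (r : ℕ) * α * L * s) + d * (6 * (1000 * l + 1)) := by ring
      _ ≤ _ := by gcongr
  have hsum : ((∑ r : Fin L, (m - 1) / 2 ^ (r : ℕ) * (6 * levelSize 1000 m α ε δ r) : ℕ) : ℝ) ≤
      12000 * (m * α * L ^ 2 * s) + 2 * m * (6 * (1000 * l + 1)) := by
    rw [Nat.cast_sum]
    refine (Finset.sum_le_sum fun r _ => hnode r).trans ?_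
    rw [Finset.sum_add_distrib, Finset.sum_const, Finset.card_univ, Fintype.card_fin,
      nsmul_eq_mul, ← Finset.sum_mul]
    refine add_le_add (le_of_eq (by ring)) ?_
    exact mul_le_mul_of_nonneg_right (sum_natDiv_two_pow_le m L) (by positivity)
  have hL2 : (L : ℝ) ^ 2 ≤ 9 * Real.log m ^ 2 := by
    calc (L : ℝ) ^ 2 ≤ (3 * Real.log m) ^ 2 := by gcongr; exact numLevels_le hm
      _ = _ := by ring
  have h3 : m * α * L ^ 2 * s ≤ 9 * (m * α * Real.log m ^ 2 * s) := by
    calc m * α * L ^ 2 * s ≤ m * α * (9 * Real.log m ^ 2) * s := by gcongr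
      _ = _ := by ring
  have h4 : 0 ≤ m * α * Real.log m ^ 2 * s := by positivity
  have h5 : 2 * l ≤ m * l := by gcongr
  have h6 : (m : ℝ) * (1 / 2) ≤ m * l := by gcongr
  rw [Nat.cast_add, Nat.cast_mul, Nat.cast_ofNat]
  linarith

theorem mainTheorem10 :
    ∃ c C : ℝ, 0 < c ∧ 0 < C ∧
      ∀ (n m : ℕ) (hm : 2 ≤ m) (α ε δ : ℝ), 0 < α → 0 < ε → 0 < δ → δ < 1 →
        -- the number of queries, for all matrices and all outcomes of the randomness
        (∀ (A : Fin m → Matrix (Fin n) (Fin n) ℝ) (ω : TreeSeed c n m α ε δ),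
          (((treeAlgorithm c n m (by omega) α ε δ ω).queryCount A : ℕ) : ℝ) ≤
            C * ((m * α * Real.log m ^ 2 + 1) * (√(Real.log (m / δ)) / ε) +
              m * Real.log (m / δ))) ∧
        -- the `i`-th estimate depends only on the first `i` matrices
        (∀ (A A' : Fin m → Matrix (Fin n) (Fin n) ℝ) (ω : TreeSeed c n m α ε δ) (i : Fin m),
          (∀ j ≤ i, A j = A' j) →
            (treeAlgorithm c n m (by omega) α ε δ ω).output A i =
              (treeAlgorithm c n m (by omega) α ε δ ω).output A' i) ∧
        -- the accuracy, under the norm bounds, for a uniformly random seed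
        (∀ A : Fin m → Matrix (Fin n) (Fin n) ℝ,
          nuclearNorm (A ⟨0, by omega⟩) ≤ 1 →
          (∀ (i : ℕ) (hi : i + 1 < m),
            nuclearNorm (A ⟨i + 1, hi⟩ - A ⟨i, by omega⟩) ≤ α) →
          1 - δ ≤ (ProbabilityTheory.uniformOn (Set.univ : Set (TreeSeed c n m α ε δ))).real
            {ω | ∀ i : Fin m,
              |(treeAlgorithm c n m (by omega) α ε δ ω).output A i - (A i).trace| ≤ ε}) := by
  refine ⟨1000, 200000, by norm_num, by norm_num, fun n m hm α ε δ hα hε hδ hδ1 =>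
    ⟨fun A ω => queryCount_treeAlgorithm_le hm hα hε hδ hδ1 A ω,
      fun A A' ω i h => output_treeAlgorithm_congr _ A A' ω i h, fun A hA0 hA => ?_⟩⟩
  rw [uniformOn_real_eq_unifProb]
  exact one_sub_le_unifProb_treeAlgorithm hm hα hε hδ hδ1 A hA0 hA
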